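/- **Conventions.** Let $M$ be a smooth (finite-dimensional, Hausdorff, second countable) manifold and $\varphi:M\to M$ a diffeomorphism, with pullback $\varphi^*f=f\circ\varphi$ on $C^\infty(M)$. A *Hom-bundle* $(A,\varphi,\phi_A)$ is a vector bundle $A\to M$ with a linear bijection $\phi_A:\Gamma(A)\to\Gamma(A)$ such that $\phi_A(fx)=\varphi^*(f)\phi_A(x)$. Its dual is $(A^*,\varphi,\phi_A^\dagger)$, where $\phi_A^\dagger(\xi)(x)=\varphi^*\big(\xi(\phi_A^{-1}x)\big)$. On $2$-forms put $\phi_A^\dagger(\Xi)(x,y)=\varphi^*\big(\Xi(\phi_A^{-1}x,\phi_A^{-1}y)\big)$, and on multivectors $\phi_A(x_1\wedge\dots\wedge x_k)=\phi_A(x_1)\wedge\dots\wedge\phi_A(x_k)$. A section $x$ of the pullback bundle $\varphi^!TM$ (with fibre $T_{\varphi(m)}M$ at $m$) acts on $C^\infty(M)$ by $x(f)(m)=df_{\varphi(m)}(x_m)$; these are exactly the $(\varphi^*,\varphi^*)$-derivations. Put $\mathrm{Ad}_{\varphi^*}(x)=\varphi^*\circ x\circ(\varphi^*)^{-1}$ and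 $$[x,y]_{\varphi^*}=\varphi^*\circ x\circ(\varphi^*)^{-1}\circ y\circ(\varphi^*)^{-1}-\varphi^*\circ y\circ(\varphi^*)^{-1}\circ x\circ(\varphi^*)^{-1}.$$ Let $\varphi^!T^*M$ be the dual bundle of $\varphi^!TM$. A *Hom-Lie algebroid* $(A,\varphi,\phi_A,[\cdot,\cdot]_A,a_A)$ is a Hom-bundle $(A,\varphi,\phi_A)$ with an $\mathbb R$-bilinear skew-symmetric bracket on $\Gamma(A)$ and a bundle map $a_A:A\to\varphi^!TM$ over $\mathrm{id}_M$ (the anchor) such that for all $x,y,z\in\Gamma(A)$, $f\in C^\infty(M)$: 1. $\phi_A[x,y]_A=[\phi_Ax,\phi_Ay]_A$ and $[\phi_Ax,[y,z]_A]_A+[\phi_Ay,[z,x]_A]_A+[\phi_Az,[x,y]_A]_A=0$; 2. $[x,fy]_A=\varphi^*(f)[x,y]_A+a_A(\phi_Ax)(f)\,\phi_A(y)$; 3. $a_A(\phi_Ax)\circ\varphi^*=\varphi^*\circ a_A(x)$ and $a_A([x,y]_A)\circ\varphi^*=a_A(\phi_Ax)\circ a_A(y)-a_A(\phi_Ay)\circ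 a_A(x)$. In particular $(\varphi^!TM,\varphi,\mathrm{Ad}_{\varphi^*},[\cdot,\cdot]_{\varphi^*},\mathrm{id})$ is a Hom-Lie algebroid. For a Hom-Lie algebroid $A$, $x,y\in\Gamma(A)$, $f\in C^\infty(M)$, $\xi\in\Gamma(A^*)$ and a $2$-form $\Xi$ on $A$, put $df(x)=a_A(x)(f)$, $$d\xi(x,y)=a_A(x)\big(\xi(\phi_A^{-1}y)\big)-a_A(y)\big(\xi(\phi_A^{-1}x)\big)-\phi_A^\dagger(\xi)\big([\phi_A^{-1}x,\phi_A^{-1}y]_A\big),$$ $i_x\xi=\phi_A^\dagger(\xi)(\phi_Ax)$, $(i_x\Xi)(y)=\phi_A^\dagger(\Xi)(\phi_Ax,y)$, and define the Lie derivative $L_x$ on $\Gamma(A^*)$ by $L_x\circ\phi_A^\dagger=i_x\circ d+d\circ i_{\phi_A^{-1}x}$. The *Hom-Schouten bracket* of elements of $\Gamma(\wedge^2A)$ is the biadditive map with values in $\Gamma(\wedge^3A)$ given by $$[\![x_1\wedge x_2,\,y_1\wedge y_2]\!]=\sum_{i,j=1}^2(-1)^{i+j}[x_i,y_j]_A\wedge\phi_A(x_{3-i})\wedge\phi_A(y_{3-j}).$$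 A *Hom-Poisson manifold* $(M,\varphi,\pi)$ consists of $M$ and $\varphi$ as above and $\pi\in\Gamma(\wedge^2\varphi^!TM)$ such that $[\![\pi,\pi]\!]=0$ for the Hom-Lie algebroid $\varphi^!TM$ and $\mathrm{Ad}_{\varphi^*}(\pi)=\pi$. Let $\pi^\sharp:\varphi^!T^*M\to\varphi^!TM$ be given by $\eta(\pi^\sharp(\xi))=\pi(\xi,\eta)$, where $(x\wedge y)(\xi,\eta)=\xi(x)\eta(y)-\xi(y)\eta(x)$. **Theorem.** Let $(M,\varphi,\pi)$ be a Hom-Poisson manifold. For $\xi,\eta\in\Gamma(\varphi^!T^*M)$ put $$[\xi,\eta]_{\pi^\sharp}=L_{\pi^\sharp(\xi)}\eta-L_{\pi^\sharp(\eta)}\xi-d\big(\pi(\xi,\eta)\big),$$ where $L$ and $d$ are those of the Hom-Lie algebroid $\varphi^!TM$. Then $(\varphi^!T^*M,\varphi,\mathrm{Ad}_{\varphi^*}^\dagger,[\cdot,\cdot]_{\pi^\sharp},\pi^\sharp)$ is a Hom-Lie algebroid (the cotangent Hom-Lie algebroid). -/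

import Mathlib

open Bundle
open scoped Manifold ContDiff Topology

set_option linter.unusedSectionVars false

noncomputable section

namespace HomPoisson

section Sections

variable {E : Type*} [NormedAddCommGroup E] [NormedSpace ℝ E]
  {M : Type*} [TopologicalSpace M] [ChartedSpace E M]

variable (E M) in
/-- The algebra `C^∞(M)` of smooth real functions on `M`. -/
abbrev SmoothFun : Type _ := C^∞⟮𝓘(ℝ, E), M; 𝓘(ℝ, ℝ), ℝ⟯

variable (E) in
/-- The space `Γ(A)` of smooth sections of a vector bundle `A` with model fibre `F`. -/
abbrev Sec (F : Type*) [NormedAddCommGroup F] [NormedSpace ℝ F]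
    (A : M → Type*) [TopologicalSpace (TotalSpace F A)] [∀ m, TopologicalSpace (A m)]
    [FiberBundle F A] : Type _ :=
  Cₛ^∞⟮𝓘(ℝ, E); F, A⟯

/-- The dual bundle `A^*`. -/
abbrev DualBundle (A : M → Type*) [∀ m, AddCommGroup (A m)] [∀ m, Module ℝ (A m)]
    [∀ m, TopologicalSpace (A m)] : M → Type _ :=
  fun m => A m →L[ℝ] ℝ

variable {F : Type*} [NormedAddCommGroup F] [NormedSpace ℝ F]
  {A : M → Type*} [∀ m, AddCommGroup (A m)] [∀ m, Module ℝ (A m)]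
  [∀ m, TopologicalSpace (A m)] [TopologicalSpace (TotalSpace F A)]
  [FiberBundle F A] [VectorBundle ℝ F A]

/-- Multiplication of sections by smooth functions. -/
instance Sec.instSMul : SMul (SmoothFun E M) (Sec E F A) where
  smul f s := ⟨fun m => f m • s m, f.contMDiff.smul_section s.contMDiff⟩

theorem Sec.fun_smul_apply (f : SmoothFun E M) (s : Sec E F A) (m : M) :
    (f • s) m = f m • s m := rfl

theorem Sec.add_apply (s t : Sec E F A) (m : M) : (s + t) m = s m + t m := rfl

theorem Sec.sub_apply (s t : Sec E F A) (m : M) : (s - t) m = s m - t m := rfl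

theorem Sec.neg_apply (s : Sec E F A) (m : M) : (-s) m = -(s m) := rfl

theorem Sec.smul_apply (c : ℝ) (s : Sec E F A) (m : M) : (c • s) m = c • s m := rfl

theorem Sec.sum_apply {ι : Type*} [Fintype ι] (s : ι → Sec E F A) (m : M) :
    (∑ i, s i) m = ∑ i, s i m := by
  have h := congrFun (map_sum (ContMDiffSection.coeAddHom 𝓘(ℝ, E) F ∞ A) s Finset.univ) m
  rwa [Finset.sum_apply] at h

/-- `Γ(A)` is a module over `C^∞(M)`. -/
instance Sec.instModule : Module (SmoothFun E M) (Sec E F A) where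
  one_smul s := by ext m; exact one_smul ℝ (s m)
  mul_smul f g s := by ext m; exact mul_smul (f m) (g m) (s m)
  smul_zero f := by ext m; exact smul_zero (f m)
  smul_add f s t := by ext m; exact smul_add (f m) (s m) (t m)
  add_smul f g s := by ext m; exact add_smul (f m) (g m) (s m)
  zero_smul s := by ext m; exact zero_smul ℝ (s m)

/-- The pairing `⟨ξ, x⟩` of a section of `A^*` with a section of `A`. -/
def pair (ξ : Sec E (F →L[ℝ] ℝ) (DualBundle A)) (x : Sec E F A) : SmoothFun E M :=
  ⟨fun m => ξ m (x m), by
    have h := ContMDiff.clm_bundle_apply (F₁ := F) (F₂ := ℝ) (E₁ := A) (E₂ := Bundle.Trivial M ℝ)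
      (b := fun m => m) ξ.contMDiff x.contMDiff
    intro m
    exact ((contMDiffAt_section m).1 (h m))⟩

theorem pair_apply (ξ : Sec E (F →L[ℝ] ℝ) (DualBundle A)) (x : Sec E F A) (m : M) :
    pair ξ x m = ξ m (x m) := rfl

end Sections

section Duality

variable {E : Type*} [NormedAddCommGroup E] [NormedSpace ℝ E] [FiniteDimensional ℝ E]
  {M : Type*} [TopologicalSpace M] [ChartedSpace E M] [IsManifold 𝓘(ℝ, E) ∞ M] [T2Space M]

theorem exists_bump {u : Set M} {m₀ : M} (hu : u ∈ 𝓝 m₀) :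
    ∃ ψ : SmoothFun E M, tsupport ψ ⊆ u ∧ ∀ᶠ m in 𝓝 m₀, ψ m = 1 := by
  obtain ⟨f, -, hf⟩ := (SmoothBumpFunction.nhds_basis_tsupport (I := 𝓘(ℝ, E)) m₀).mem_iff.1 hu
  exact ⟨⟨f, f.contMDiff⟩, hf, f.eventuallyEq_one⟩

variable {F : Type*} [NormedAddCommGroup F] [NormedSpace ℝ F]
  {A : M → Type*} [∀ m, AddCommGroup (A m)] [∀ m, Module ℝ (A m)]
  [∀ m, TopologicalSpace (A m)] [TopologicalSpace (TotalSpace F A)]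
  [FiberBundle F A] [VectorBundle ℝ F A]

/-- Cutting off a section that is smooth on an open set. -/
def cutoff (ψ : SmoothFun E M) (s : ∀ m, A m) {u : Set M} (hu : IsOpen u)
    (hψ : tsupport ψ ⊆ u)
    (hs : ContMDiffOn 𝓘(ℝ, E) (𝓘(ℝ, E).prod 𝓘(ℝ, F)) ∞ (fun m => TotalSpace.mk' F m (s m)) u) :
    Sec E F A :=
  ⟨fun m => ψ m • s m,
    ContMDiffOn.smul_section_of_tsupport ψ.contMDiff.contMDiffOn hu hψ hs⟩

/-- Cutting off a function that is smooth on an open set. -/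
def cutoffFun (ψ : SmoothFun E M) (s : M → ℝ) {u : Set M} (hu : IsOpen u)
    (hψ : tsupport ψ ⊆ u) (hs : ContMDiffOn 𝓘(ℝ, E) 𝓘(ℝ, ℝ) ∞ s u) :
    SmoothFun E M :=
  ⟨fun m => ψ m * s m, by
    refine contMDiff_of_tsupport fun m hm => ?_
    have hm' : m ∈ u := hψ (closure_mono (by
      intro y hy hy'
      exact hy (by simp [hy'])) hm)
    exact ψ.contMDiff.contMDiffAt.mul ((hs m hm').contMDiffAt (hu.mem_nhds hm'))⟩

variable [FiniteDimensional ℝ F] [ContMDiffVectorBundle ∞ F A 𝓘(ℝ, E)]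

/-- A section of `A^*` is smooth at a point as soon as its values on a local frame are. -/
theorem contMDiffAt_dual_of_frame {ξ : ∀ m, DualBundle A m} {m₀ : M}
    (h : ∀ i, ContMDiffAt 𝓘(ℝ, E) 𝓘(ℝ, ℝ) ∞ (fun m => ξ m
      ((trivializationAt F A m₀).localFrame (Module.finBasis ℝ F) i m)) m₀) :
    ContMDiffAt 𝓘(ℝ, E) (𝓘(ℝ, E).prod 𝓘(ℝ, F →L[ℝ] ℝ)) ∞
      (fun m => TotalSpace.mk' (F →L[ℝ] ℝ) (E := DualBundle A) m (ξ m)) m₀ := by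
  rw [contMDiffAt_section]
  have hsm : ContMDiffAt 𝓘(ℝ, E) 𝓘(ℝ, F →L[ℝ] ℝ) ∞ (fun m => ∑ i, (ξ m
      ((trivializationAt F A m₀).localFrame (Module.finBasis ℝ F) i m)) •
        (LinearMap.toContinuousLinearMap ((Module.finBasis ℝ F).coord i))) m₀ := by
    refine ContMDiffAt.sum (I := 𝓘(ℝ, F →L[ℝ] ℝ)) fun i _ => ?_
    exact (h i).smul contMDiffAt_const
  refine hsm.congr_of_eventuallyEq ?_
  filter_upwards [(trivializationAt F A m₀).open_baseSet.mem_nhds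
    (FiberBundle.mem_baseSet_trivializationAt' m₀)] with m hm
  rw [hom_trivializationAt_apply]
  refine (LinearMap.toContinuousLinearMap (𝕜 := ℝ)).symm.injective ?_
  refine (Module.finBasis ℝ F).ext fun j => ?_
  have hm' : m ∈ (trivializationAt ℝ (Bundle.Trivial M ℝ) m₀).baseSet := by simp
  simp [ContinuousLinearMap.inCoordinates_eq hm hm', Bundle.Trivialization.localFrame_apply_of_mem_baseSet _ _ hm, Bundle.Trivialization.basisAt, Finsupp.single_apply]

theorem exists_section_eq {m₀ : M} (v : A m₀) : ∃ s : Sec E F A, s m₀ = v := by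
  set e := trivializationAt F A m₀
  have hm₀ : m₀ ∈ e.baseSet := FiberBundle.mem_baseSet_trivializationAt' m₀
  obtain ⟨ψ, hψ, hψ1⟩ := exists_bump (E := E) (e.open_baseSet.mem_nhds hm₀)
  let b := Module.finBasis ℝ F
  let t := fun i => cutoff (E := E) (F := F) ψ (e.localFrame b i) e.open_baseSet hψ
    (e.contMDiffOn_localFrame_baseSet _ b i)
  refine ⟨∑ i, (e.basisAt b hm₀).repr v i • t i, ?_⟩
  have : (∑ i, (e.basisAt b hm₀).repr v i • t i) m₀
      = ∑ i, (e.basisAt b hm₀).repr v i • (t i m₀) := Sec.sum_apply _ _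
  rw [this]
  conv_rhs => rw [← (e.basisAt b hm₀).sum_repr v]
  refine Finset.sum_congr rfl fun i _ => ?_
  congr 1
  change ψ m₀ • e.localFrame b i m₀ = _
  rw [hψ1.self_of_nhds, one_smul, e.localFrame_apply_of_mem_baseSet b hm₀]

/-- The coefficient functionals of a local frame, cut off to global sections of `A^*`. -/
theorem exists_coeff_section (m₀ : M) (i : Fin (Module.finrank ℝ F)) :
    ∃ ξ : Sec E (F →L[ℝ] ℝ) (DualBundle A), ∀ᶠ m in 𝓝 m₀, ∀ v : A m,
      ξ m v = (trivializationAt F A m₀).localFrameCoeff 𝓘(ℝ, E) (Module.finBasis ℝ F) i m v := by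
  set e := trivializationAt F A m₀
  have hm₀ : m₀ ∈ e.baseSet := FiberBundle.mem_baseSet_trivializationAt' m₀
  obtain ⟨ψ, hψ, hψ1⟩ := exists_bump (E := E) (e.open_baseSet.mem_nhds hm₀)
  have hfd : ∀ m, FiniteDimensional ℝ (A m) := fun m => VectorBundle.finiteDimensional ℝ F A m
  have ht2 : ∀ m, T2Space (A m) := fun m => FiberBundle.t2Space F A m
  have hag : ∀ m, IsTopologicalAddGroup (A m) := fun m =>
    (VectorBundle.continuousLinearEquivAt ℝ F A m).toContinuousAddEquiv.isTopologicalAddGroup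
  have hcs : ∀ m, ContinuousSMul ℝ (A m) := fun m =>
    (VectorBundle.continuousLinearEquivAt ℝ F A m).continuousSMul
  let c : ∀ m, DualBundle A m := fun m =>
    LinearMap.toContinuousLinearMap (e.localFrameCoeff 𝓘(ℝ, E) (Module.finBasis ℝ F) i m)
  have hc : ContMDiffOn 𝓘(ℝ, E) (𝓘(ℝ, E).prod 𝓘(ℝ, F →L[ℝ] ℝ)) ∞
      (fun m => TotalSpace.mk' (F →L[ℝ] ℝ) (E := DualBundle A) m (c m)) e.baseSet := by
    intro m₁ hm₁
    refine (contMDiffAt_dual_of_frame fun j => ?_).contMDiffWithinAt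
    exact contMDiffAt_localFrameCoeff (Module.finBasis ℝ F) hm₁
      (contMDiffAt_localFrame_of_mem ∞ (trivializationAt F A m₁) (Module.finBasis ℝ F) j
        (FiberBundle.mem_baseSet_trivializationAt' m₁)) i
  refine ⟨cutoff (E := E) (F := F →L[ℝ] ℝ) ψ c e.open_baseSet hψ hc, ?_⟩
  filter_upwards [hψ1] with m hm v
  change (ψ m • c m) v = _
  rw [hm, one_smul]
  rfl

/-- A field of vectors is smooth as soon as all its pairings with smooth sections of `A^*` are. -/
theorem contMDiff_of_pair {v : ∀ m, A m}
    (h : ∀ ξ : Sec E (F →L[ℝ] ℝ) (DualBundle A),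
      ContMDiff 𝓘(ℝ, E) 𝓘(ℝ, ℝ) ∞ (fun m => ξ m (v m))) :
    ContMDiff 𝓘(ℝ, E) (𝓘(ℝ, E).prod 𝓘(ℝ, F)) ∞ (fun m => TotalSpace.mk' F m (v m)) := by
  intro m₀
  rw [contMDiffAt_iff_localFrameCoeff (Module.finBasis ℝ F)
    (FiberBundle.mem_baseSet_trivializationAt' (F := F) (E := A) m₀)]
  intro i
  obtain ⟨ξ, hξ⟩ := exists_coeff_section (E := E) (F := F) (A := A) m₀ i
  refine (h ξ m₀).congr_of_eventuallyEq ?_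
  filter_upwards [hξ] with m hm
  exact (hm (v m)).symm

theorem linear_apply_eq_zero (θ : Sec E F A →ₗ[SmoothFun E M] SmoothFun E M) {s : Sec E F A}
    {m₀ : M} (hs : s m₀ = 0) : θ s m₀ = 0 := by
  set e := trivializationAt F A m₀
  have hm₀ : m₀ ∈ e.baseSet := FiberBundle.mem_baseSet_trivializationAt' m₀
  obtain ⟨ψ, hψ, hψ1⟩ := exists_bump (E := E) (e.open_baseSet.mem_nhds hm₀)
  let b := Module.finBasis ℝ F
  let t := fun i => cutoff (E := E) (F := F) ψ (e.localFrame b i) e.open_baseSet hψ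
    (e.contMDiffOn_localFrame_baseSet _ b i)
  let c := fun i => cutoffFun (E := E) ψ (fun m => e.localFrameCoeff 𝓘(ℝ, E) b i m (s m))
    e.open_baseSet hψ (fun m hm =>
      (contMDiffAt_localFrameCoeff b hm (s.contMDiff m) i).contMDiffWithinAt)
  have key : (ψ * ψ) • s = ∑ i, c i • t i := by
    ext m
    have : (∑ i, c i • t i) m = ∑ i, c i m • t i m := Sec.sum_apply _ _
    rw [this]
    change (ψ m * ψ m) • s m = ∑ i, (ψ m * e.localFrameCoeff 𝓘(ℝ, E) b i m (s m)) •
      (ψ m • e.localFrame b i m)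
    by_cases hm : m ∈ e.baseSet
    · conv_lhs => rw [e.eq_sum_localFrameCoeff_smul (I := 𝓘(ℝ, E)) (b := b) (s := s) hm]
      rw [Finset.smul_sum]
      refine Finset.sum_congr rfl fun i _ => ?_
      simp only [smul_smul]
      congr 1
      ring
    · have : ψ m = 0 := image_eq_zero_of_notMem_tsupport fun h => hm (hψ h)
      simp [this]
  have h1 : θ ((ψ * ψ) • s) m₀ = θ s m₀ := by
    rw [map_smul]
    change (ψ m₀ * ψ m₀) * θ s m₀ = _
    rw [hψ1.self_of_nhds]; ring
  rw [← h1, key, map_sum]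
  have : (∑ i, θ (c i • t i)) m₀ = ∑ i, c i m₀ * θ (t i) m₀ := by
    have := map_sum (ContMDiffMap.coeFnAddMonoidHom (I := 𝓘(ℝ, E)) (I' := 𝓘(ℝ, ℝ)) (N := M)
      (n := ∞) (G := ℝ)) (fun i => θ (c i • t i)) Finset.univ
    have := congrFun this m₀
    simpa using this
  rw [this]
  refine Finset.sum_eq_zero fun i _ => ?_
  have : c i m₀ = 0 := by
    change ψ m₀ * e.localFrameCoeff 𝓘(ℝ, E) b i m₀ (s m₀) = 0
    rw [hs, map_zero, mul_zero]
  rw [this, zero_mul]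

theorem linear_apply_congr (θ : Sec E F A →ₗ[SmoothFun E M] SmoothFun E M) {s t : Sec E F A}
    {m₀ : M} (hst : s m₀ = t m₀) : θ s m₀ = θ t m₀ := by
  have h := linear_apply_eq_zero θ (s := s - t) (m₀ := m₀)
    (by rw [Sec.sub_apply, hst, sub_self])
  rw [map_sub] at h
  exact sub_eq_zero.1 h

/-- `C^∞(M)`-linear maps `Γ(A) → C^∞(M)` are given by sections of `A^*`. -/
theorem exists_dual_section (θ : Sec E F A →ₗ[SmoothFun E M] SmoothFun E M) :
    ∃ ξ : Sec E (F →L[ℝ] ℝ) (DualBundle A), ∀ x, pair ξ x = θ x := by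
  have hfd : ∀ m, FiniteDimensional ℝ (A m) := fun m => VectorBundle.finiteDimensional ℝ F A m
  have ht2 : ∀ m, T2Space (A m) := fun m => FiberBundle.t2Space F A m
  have hag : ∀ m, IsTopologicalAddGroup (A m) := fun m =>
    (VectorBundle.continuousLinearEquivAt ℝ F A m).toContinuousAddEquiv.isTopologicalAddGroup
  have hcs : ∀ m, ContinuousSMul ℝ (A m) := fun m =>
    (VectorBundle.continuousLinearEquivAt ℝ F A m).continuousSMul
  choose ext hext using fun m => exists_section_eq (E := E) (F := F) (A := A) (m₀ := m)
  let ξ : ∀ m, DualBundle A m := fun m => LinearMap.toContinuousLinearMap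
    { toFun := fun v => θ (ext m v) m
      map_add' := fun v w => by
        rw [linear_apply_congr θ (t := ext m v + ext m w)
          (by rw [Sec.add_apply, hext, hext, hext]), map_add]
        rfl
      map_smul' := fun c v => by
        rw [linear_apply_congr θ (t := (ContMDiffMap.const c : SmoothFun E M) • ext m v)
          (by rw [Sec.fun_smul_apply, hext, hext]; rfl), map_smul]
        rfl }
  have hξ : ∀ (x : Sec E F A) m, ξ m (x m) = θ x m := fun x m =>
    linear_apply_congr θ (hext m (x m))
  refine ⟨⟨ξ, fun m₀ => contMDiffAt_dual_of_frame fun i => ?_⟩, fun x => ?_⟩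
  · set e := trivializationAt F A m₀
    have hm₀ : m₀ ∈ e.baseSet := FiberBundle.mem_baseSet_trivializationAt' m₀
    obtain ⟨ψ, hψ, hψ1⟩ := exists_bump (E := E) (e.open_baseSet.mem_nhds hm₀)
    let t := cutoff (E := E) (F := F) ψ (e.localFrame (Module.finBasis ℝ F) i) e.open_baseSet hψ
      (e.contMDiffOn_localFrame_baseSet _ (Module.finBasis ℝ F) i)
    refine ((θ t).contMDiff m₀).congr_of_eventuallyEq ?_
    filter_upwards [hψ1] with m hm
    rw [← hξ t m]
    change _ = ξ m (ψ m • _)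
    rw [hm, one_smul]
  · ext m
    exact hξ x m

theorem pair_ext {ξ η : Sec E (F →L[ℝ] ℝ) (DualBundle A)} (h : ∀ x, pair ξ x = pair η x) :
    ξ = η := by
  ext m v
  obtain ⟨x, rfl⟩ := exists_section_eq (E := E) (F := F) v
  exact DFunLike.congr_fun (h x) m

/-- The section of `A^*` representing a `C^∞(M)`-linear map `Γ(A) → C^∞(M)`. -/
def dualSection (θ : Sec E F A →ₗ[SmoothFun E M] SmoothFun E M) :
    Sec E (F →L[ℝ] ℝ) (DualBundle A) :=
  (exists_dual_section θ).choose

@[simp]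
theorem pair_dualSection (θ : Sec E F A →ₗ[SmoothFun E M] SmoothFun E M) (x : Sec E F A) :
    pair (dualSection θ) x = θ x :=
  (exists_dual_section θ).choose_spec x

end Duality

section Tangent

variable {E : Type*} [NormedAddCommGroup E] [NormedSpace ℝ E]
  {M : Type*} [TopologicalSpace M] [ChartedSpace E M]

variable (E M) in
/-- Diffeomorphisms `M → M`. -/
abbrev Diffeo : Type _ := M ≃ₘ⟮𝓘(ℝ, E), 𝓘(ℝ, E)⟯ M

/-- The pullback `φ^*` on functions, as an automorphism of the algebra `C^∞(M)`. -/
def pull (φ : Diffeo E M) : SmoothFun E M ≃ₐ[ℝ] SmoothFun E M where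
  toFun f := ⟨fun m => f (φ m), f.contMDiff.comp φ.contMDiff⟩
  invFun f := ⟨fun m => f (φ.symm m), f.contMDiff.comp φ.symm.contMDiff⟩
  left_inv f := by ext m; exact congrArg f (φ.apply_symm_apply m)
  right_inv f := by ext m; exact congrArg f (φ.symm_apply_apply m)
  map_mul' _ _ := rfl
  map_add' _ _ := rfl
  commutes' _ := rfl

theorem pull_apply (φ : Diffeo E M) (f : SmoothFun E M) (m : M) : pull φ f m = f (φ m) := rfl

theorem pull_symm_apply (φ : Diffeo E M) (f : SmoothFun E M) (m : M) :
    (pull φ).symm f m = f (φ.symm m) := rfl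

/-- The pullback bundle `φ^!TM`; its fibre at `m` is `T_{φ(m)}M`. -/
abbrev PullTangent (φ : Diffeo E M) : M → Type _ :=
  φ.toContMDiffMap *ᵖ (TangentSpace 𝓘(ℝ, E) : M → Type _)

instance PullTangent.instAddCommGroup (φ : Diffeo E M) (m : M) : AddCommGroup (PullTangent φ m) :=
  inferInstanceAs (AddCommGroup (TangentSpace 𝓘(ℝ, E) (φ m)))

instance PullTangent.instIsTopologicalAddGroup (φ : Diffeo E M) (m : M) :
    IsTopologicalAddGroup (PullTangent φ m) :=
  inferInstanceAs (IsTopologicalAddGroup (TangentSpace 𝓘(ℝ, E) (φ m)))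

instance PullTangent.instContinuousSMul (φ : Diffeo E M) (m : M) :
    ContinuousSMul ℝ (PullTangent φ m) :=
  inferInstanceAs (ContinuousSMul ℝ (TangentSpace 𝓘(ℝ, E) (φ m)))

/-- The pullback bundle `φ^!T^*M`, the dual of `φ^!TM`; its fibre at `m` is `T^*_{φ(m)}M`. -/
abbrev PullCotangent (φ : Diffeo E M) : M → Type _ := DualBundle (PullTangent φ)

variable [IsManifold 𝓘(ℝ, E) ∞ M]

/-- A section `x` of `φ^!TM` is smooth iff `m ↦ (φ(m), x_m)` is a smooth map into `TM`. -/
theorem contMDiff_pullTangent_iff {φ : Diffeo E M} {x : ∀ m, PullTangent φ m} :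
    ContMDiff 𝓘(ℝ, E) (𝓘(ℝ, E).prod 𝓘(ℝ, E)) ∞
        (fun m => TotalSpace.mk' E (E := PullTangent φ) m (x m)) ↔
      ContMDiff 𝓘(ℝ, E) (𝓘(ℝ, E).prod 𝓘(ℝ, E)) ∞
        (fun m => TotalSpace.mk' E (E := (TangentSpace 𝓘(ℝ, E) : M → Type _)) (φ m) (x m)) := by
  refine forall_congr' fun m₀ => ?_
  rw [contMDiffAt_section, contMDiffAt_totalSpace]
  exact ⟨fun h => ⟨φ.contMDiff m₀, h⟩, fun h => h.2⟩

/-- The operator on `C^∞(M)` given by a section `x` of `φ^!TM`: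
`x(f)(m) = df_{φ(m)}(x_m)`. -/
def act {φ : Diffeo E M} (x : Sec E E (PullTangent φ)) (f : SmoothFun E M) : SmoothFun E M :=
  ⟨fun m => (mfderiv 𝓘(ℝ, E) 𝓘(ℝ, ℝ) f (φ m) (x m) : ℝ), by
    have h1 := contMDiff_pullTangent_iff.1 x.contMDiff
    have h2 := (f.contMDiff.contMDiff_tangentMap (m := ∞) (by simp)).comp h1
    exact (contMDiff_snd_tangentBundle_modelSpace ℝ 𝓘(ℝ, ℝ)).comp h2⟩

theorem act_apply {φ : Diffeo E M} (x : Sec E E (PullTangent φ)) (f : SmoothFun E M) (m : M) :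
    act x f m = (mfderiv 𝓘(ℝ, E) 𝓘(ℝ, ℝ) f (φ m) (x m) : ℝ) := rfl

theorem act_add {φ : Diffeo E M} (x : Sec E E (PullTangent φ)) (f g : SmoothFun E M) :
    act x (f + g) = act x f + act x g := by
  ext m
  have hf : MDifferentiableAt 𝓘(ℝ, E) 𝓘(ℝ, ℝ) f (φ m) := f.mdifferentiableAt
  have hg : MDifferentiableAt 𝓘(ℝ, E) 𝓘(ℝ, ℝ) g (φ m) := g.mdifferentiableAt
  exact congrArg (fun L => L (x m)) (mfderiv_add hf hg)

/-- Sections of `φ^!TM` act as `(φ^*, φ^*)`-derivations. -/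
theorem act_mul {φ : Diffeo E M} (x : Sec E E (PullTangent φ)) (f g : SmoothFun E M) :
    act x (f * g) = act x f * pull φ g + pull φ f * act x g := by
  ext m
  have hf : MDifferentiableAt 𝓘(ℝ, E) 𝓘(ℝ, ℝ) f (φ m) := f.mdifferentiableAt
  have hg : MDifferentiableAt 𝓘(ℝ, E) 𝓘(ℝ, ℝ) g (φ m) := g.mdifferentiableAt
  have h := congrArg (fun L => L (x m)) (hf.hasMFDerivAt.mul hg.hasMFDerivAt).mfderiv
  refine h.trans ?_
  change f (φ m) * act x g m + g (φ m) * act x f m = act x f m * g (φ m) + f (φ m) * act x g m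
  ring

theorem act_section_add {φ : Diffeo E M} (x y : Sec E E (PullTangent φ)) (f : SmoothFun E M) :
    act (x + y) f = act x f + act y f := by
  ext m
  exact map_add (mfderiv 𝓘(ℝ, E) 𝓘(ℝ, ℝ) f (φ m)) (x m) (y m)

theorem act_section_smul {φ : Diffeo E M} (g : SmoothFun E M) (x : Sec E E (PullTangent φ))
    (f : SmoothFun E M) : act (g • x) f = g * act x f := by
  ext m
  exact map_smul (mfderiv 𝓘(ℝ, E) 𝓘(ℝ, ℝ) f (φ m)) (g m) (x m)

theorem act_section_real_smul {φ : Diffeo E M} (c : ℝ) (x : Sec E E (PullTangent φ))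
    (f : SmoothFun E M) : act (c • x) f = c • act x f := by
  ext m
  exact map_smul (mfderiv 𝓘(ℝ, E) 𝓘(ℝ, ℝ) f (φ m)) c (x m)

section Injective

variable [FiniteDimensional ℝ E] [T2Space M]

theorem eq_zero_of_forall_mfderiv {p : M} {v : TangentSpace 𝓘(ℝ, E) p}
    (h : ∀ f : SmoothFun E M, mfderiv 𝓘(ℝ, E) 𝓘(ℝ, ℝ) f p v = 0) : v = 0 := by
  obtain ⟨ψ⟩ := (inferInstance : Nonempty (SmoothBumpFunction 𝓘(ℝ, E) p))
  have hinv := isInvertible_mfderiv_extChartAt (I := 𝓘(ℝ, E)) (mem_extChartAt_source (I := 𝓘(ℝ, E)) p)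
  have hD : MDifferentiableAt 𝓘(ℝ, E) 𝓘(ℝ, E) (extChartAt 𝓘(ℝ, E) p) p :=
    mdifferentiableAt_extChartAt (mem_chart_source E p)
  have key : ∀ l : E →L[ℝ] ℝ,
      l (mfderiv 𝓘(ℝ, E) 𝓘(ℝ, E) (extChartAt 𝓘(ℝ, E) p) p v) = 0 := by
    intro l
    have hl : ContMDiffOn 𝓘(ℝ, E) 𝓘(ℝ, ℝ) ∞ (fun q => l (extChartAt 𝓘(ℝ, E) p q))
        (chartAt E p).source :=
      l.contMDiff.comp_contMDiffOn contMDiffOn_extChartAt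
    have hψl : ContMDiff 𝓘(ℝ, E) 𝓘(ℝ, ℝ) ∞ (fun q => ψ q • l (extChartAt 𝓘(ℝ, E) p q)) :=
      ψ.contMDiff_smul hl
    let f : SmoothFun E M := ⟨_, hψl⟩
    have hf : (f : M → ℝ) =ᶠ[𝓝 p] l ∘ extChartAt 𝓘(ℝ, E) p := by
      filter_upwards [ψ.eventuallyEq_one] with q hq
      change ψ q • l (extChartAt 𝓘(ℝ, E) p q) = _
      rw [hq]
      simp
    have h1 := h f
    rw [hf.mfderiv_eq, mfderiv_comp p l.mdifferentiableAt hD] at h1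
    rw [l.hasMFDerivAt.mfderiv] at h1
    exact h1
  have h0 : mfderiv 𝓘(ℝ, E) 𝓘(ℝ, E) (extChartAt 𝓘(ℝ, E) p) p v = 0 := by
    exact (SeparatingDual.eq_zero_iff_forall_dual_eq_zero (R := ℝ) (V := E) _).2 key
  obtain ⟨L, hL⟩ := hinv
  rw [← hL] at h0
  exact L.map_eq_zero_iff.1 h0

/-- A section of `φ^!TM` is determined by its action on functions. -/
theorem act_injective {φ : Diffeo E M} {x y : Sec E E (PullTangent φ)}
    (h : ∀ f, act x f = act y f) : x = y := by
  ext m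
  refine sub_eq_zero.1 (eq_zero_of_forall_mfderiv (p := φ m) fun f => ?_)
  have := DFunLike.congr_fun (h f) m
  rw [act_apply, act_apply] at this
  exact (map_sub (mfderiv 𝓘(ℝ, E) 𝓘(ℝ, ℝ) f (φ m)) (x m) (y m)).trans (sub_eq_zero.2 this)

end Injective

/-- The derivative of `f` at `p` in the direction of `v`. -/
def dirDeriv (f : M → ℝ) (p : M) (v : TangentSpace 𝓘(ℝ, E) p) : ℝ :=
  mfderiv 𝓘(ℝ, E) 𝓘(ℝ, ℝ) f p v

theorem mfderiv_apply_congr {f : M → ℝ} {p q : M} (h : p = q) (v : E) :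
    (mfderiv 𝓘(ℝ, E) 𝓘(ℝ, ℝ) f p v : ℝ) = mfderiv 𝓘(ℝ, E) 𝓘(ℝ, ℝ) f q v := by
  subst h; rfl

theorem totalSpace_mk_congr {p q : M} (h : p = q) (v : E) :
    TotalSpace.mk' E (E := (TangentSpace 𝓘(ℝ, E) : M → Type _)) p v = TotalSpace.mk' E q v := by
  subst h; rfl

/-- The section `m ↦ T_{φ(φ(m))}(φ^{-1}) (x_{φ(m)})` of `φ^!TM`. -/
def adSec (φ : Diffeo E M) (x : Sec E E (PullTangent φ)) : Sec E E (PullTangent φ) :=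
  ⟨fun m => (mfderiv 𝓘(ℝ, E) 𝓘(ℝ, E) φ.symm (φ (φ m)) (x (φ m)) : E), by
    refine contMDiff_pullTangent_iff.2 ?_
    have h1 := (contMDiff_pullTangent_iff.1 x.contMDiff).comp φ.contMDiff
    have h2 := (φ.symm.contMDiff.contMDiff_tangentMap (m := ∞) (by simp)).comp h1
    refine h2.congr fun m => ?_
    exact (totalSpace_mk_congr (φ.symm_apply_apply (φ m)) _).symm⟩

/-- `Ad_{φ^*}(x) = φ^* ∘ x ∘ (φ^*)^{-1}`. -/
theorem act_adSec (φ : Diffeo E M) (x : Sec E E (PullTangent φ)) (f : SmoothFun E M) :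
    act (adSec φ x) f = pull φ (act x ((pull φ).symm f)) := by
  ext m
  rw [act_apply, pull_apply, act_apply]
  have h := mfderiv_comp (I := 𝓘(ℝ, E)) (I' := 𝓘(ℝ, E)) (I'' := 𝓘(ℝ, ℝ)) (φ (φ m))
    (f.mdifferentiableAt (x := φ.symm (φ (φ m))))
    ((φ.symm.contMDiff (φ (φ m))).mdifferentiableAt (by simp))
  have h' := congrArg (fun L => L (x (φ m))) h
  exact (mfderiv_apply_congr (φ.symm_apply_apply (φ m)).symm _).trans h'.symm

/-- The section `m ↦ T_m φ (x_{φ^{-1}(m)})` of `φ^!TM`. -/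
def adInvSec (φ : Diffeo E M) (x : Sec E E (PullTangent φ)) : Sec E E (PullTangent φ) :=
  ⟨fun m => (mfderiv 𝓘(ℝ, E) 𝓘(ℝ, E) φ m (x (φ.symm m)) : E), by
    refine contMDiff_pullTangent_iff.2 ?_
    have h1 := (contMDiff_pullTangent_iff.1 x.contMDiff).comp φ.symm.contMDiff
    have h2 := (φ.contMDiff.contMDiff_tangentMap (m := ∞) (by simp)).comp h1
    refine h2.congr fun m => ?_
    exact (congrArg (tangentMap 𝓘(ℝ, E) 𝓘(ℝ, E) φ)
      (totalSpace_mk_congr (E := E) (φ.apply_symm_apply m) (x (φ.symm m)))).symm⟩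

theorem act_adInvSec (φ : Diffeo E M) (x : Sec E E (PullTangent φ)) (f : SmoothFun E M) :
    act (adInvSec φ x) f = (pull φ).symm (act x (pull φ f)) := by
  ext m
  rw [act_apply, pull_symm_apply, act_apply]
  have h := mfderiv_comp (I := 𝓘(ℝ, E)) (I' := 𝓘(ℝ, E)) (I'' := 𝓘(ℝ, ℝ)) m
    (f.mdifferentiableAt (x := φ m)) ((φ.contMDiff m).mdifferentiableAt (by simp))
  have h' := congrArg (fun L => L (x (φ.symm m))) h
  exact h'.symm.trans (mfderiv_apply_congr (φ.apply_symm_apply m).symm _)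

section Bracket

variable [CompleteSpace E]

theorem fderiv_chart_apply {p : M} {u : E} (hu : u ∈ (extChartAt 𝓘(ℝ, E) p).target) {g : M → ℝ}
    (hg : MDifferentiableAt 𝓘(ℝ, E) 𝓘(ℝ, ℝ) g ((extChartAt 𝓘(ℝ, E) p).symm u))
    (X : ∀ q : M, TangentSpace 𝓘(ℝ, E) q) :
    fderiv ℝ (g ∘ (extChartAt 𝓘(ℝ, E) p).symm) u
      (VectorField.mpullbackWithin 𝓘(ℝ, E) 𝓘(ℝ, E) (extChartAt 𝓘(ℝ, E) p).symm X
        (Set.range 𝓘(ℝ, E)) u) =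
      dirDeriv g ((extChartAt 𝓘(ℝ, E) p).symm u) (X ((extChartAt 𝓘(ℝ, E) p).symm u)) := by
  have hinv := isInvertible_mfderivWithin_extChartAt_symm (I := 𝓘(ℝ, E)) hu
  have hd : MDifferentiableWithinAt 𝓘(ℝ, E) 𝓘(ℝ, E) (extChartAt 𝓘(ℝ, E) p).symm
      (Set.range 𝓘(ℝ, E)) u := mdifferentiableWithinAt_extChartAt_symm hu
  rw [VectorField.mpullbackWithin_apply]
  simp only [modelWithCornersSelf_coe, Set.range_id, mfderivWithin_univ,
    mdifferentiableWithinAt_univ] at hinv hd ⊢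
  have h := mfderiv_comp u hg hd
  rw [mfderiv_eq_fderiv] at h
  rw [h]
  obtain ⟨L, hL⟩ := hinv
  change mfderiv 𝓘(ℝ, E) 𝓘(ℝ, ℝ) g _ (mfderiv 𝓘(ℝ, E) 𝓘(ℝ, E) _ u _) = _
  rw [← hL, ContinuousLinearMap.inverse_equiv]
  exact congrArg (mfderiv 𝓘(ℝ, E) 𝓘(ℝ, ℝ) g ((extChartAt 𝓘(ℝ, E) p).symm u))
    (L.apply_symm_apply _)

/-- The Lie bracket of vector fields acts on functions as the commutator. -/
theorem mfderiv_mlieBracket {X Y : ∀ q : M, TangentSpace 𝓘(ℝ, E) q}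
    (hX : ContMDiff 𝓘(ℝ, E) (𝓘(ℝ, E).prod 𝓘(ℝ, E)) ∞ (fun q => TotalSpace.mk' E q (X q)))
    (hY : ContMDiff 𝓘(ℝ, E) (𝓘(ℝ, E).prod 𝓘(ℝ, E)) ∞ (fun q => TotalSpace.mk' E q (Y q)))
    (f Xf Yf : SmoothFun E M)
    (hXf : ∀ q, Xf q = dirDeriv f q (X q))
    (hYf : ∀ q, Yf q = dirDeriv f q (Y q)) (p : M) :
    dirDeriv f p (VectorField.mlieBracket 𝓘(ℝ, E) X Y p) =
      dirDeriv Yf p (X p) - dirDeriv Xf p (Y p) := by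
  set e := extChartAt 𝓘(ℝ, E) p with he
  set V' : E → E := VectorField.mpullbackWithin 𝓘(ℝ, E) 𝓘(ℝ, E) e.symm X (Set.range 𝓘(ℝ, E))
    with hV'
  set W' : E → E := VectorField.mpullbackWithin 𝓘(ℝ, E) 𝓘(ℝ, E) e.symm Y (Set.range 𝓘(ℝ, E))
    with hW'
  have hep : e p ∈ e.target := mem_extChartAt_target p
  have hsymm : e.symm (e p) = p := extChartAt_to_inv p
  have hXd : DifferentiableAt ℝ V' (e p) := by
    have h := ((hX p).mdifferentiableAt (by simp)).mdifferentiableWithinAt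
      (s := Set.univ) |>.differentiableWithinAt_mpullbackWithin_vectorField
    have hs : (extChartAt 𝓘(ℝ, E) p).symm ⁻¹' Set.univ ∩ Set.range 𝓘(ℝ, E) = Set.univ := by simp
    exact differentiableWithinAt_univ.1 (hs ▸ h)
  have hYd : DifferentiableAt ℝ W' (e p) := by
    have h := ((hY p).mdifferentiableAt (by simp)).mdifferentiableWithinAt
      (s := Set.univ) |>.differentiableWithinAt_mpullbackWithin_vectorField
    have hs : (extChartAt 𝓘(ℝ, E) p).symm ⁻¹' Set.univ ∩ Set.range 𝓘(ℝ, E) = Set.univ := by simp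
    exact differentiableWithinAt_univ.1 (hs ▸ h)
  have hf : ContDiffAt ℝ ∞ (f ∘ e.symm) (e p) := by
    have h1 : ContMDiffOn 𝓘(ℝ, E) 𝓘(ℝ, ℝ) ∞ (f ∘ e.symm) e.target :=
      f.contMDiff.comp_contMDiffOn (contMDiffOn_extChartAt_symm p)
    exact (h1.contMDiffAt (extChartAt_target_mem_nhds p)).contDiffAt
  have hnear : ∀ (Z : ∀ q : M, TangentSpace 𝓘(ℝ, E) q) (Zf : SmoothFun E M),
      (∀ q, Zf q = dirDeriv f q (Z q)) →
      (fun u => fderiv ℝ (f ∘ e.symm) u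
        (VectorField.mpullbackWithin 𝓘(ℝ, E) 𝓘(ℝ, E) e.symm Z (Set.range 𝓘(ℝ, E)) u))
        =ᶠ[𝓝 (e p)] Zf ∘ e.symm := by
    intro Z Zf hZ
    filter_upwards [extChartAt_target_mem_nhds (I := 𝓘(ℝ, E)) p] with u hu
    rw [fderiv_chart_apply hu f.mdifferentiableAt]
    exact (hZ _).symm
  have hval : ∀ (Z : ∀ q : M, TangentSpace 𝓘(ℝ, E) q) (g : SmoothFun E M),
      fderiv ℝ (g ∘ e.symm) (e p)
        (VectorField.mpullbackWithin 𝓘(ℝ, E) 𝓘(ℝ, E) e.symm Z (Set.range 𝓘(ℝ, E)) (e p)) =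
        dirDeriv g p (Z p) := by
    intro Z g
    rw [fderiv_chart_apply hep g.mdifferentiableAt]
    exact congrArg (fun q => dirDeriv g q (Z q)) hsymm
  have hbr : dirDeriv f p (VectorField.mlieBracket 𝓘(ℝ, E) X Y p) =
      fderiv ℝ (f ∘ e.symm) (e p) (VectorField.lieBracket ℝ V' W' (e p)) := by
    set w : E := VectorField.lieBracket ℝ V' W' (e p) with hw
    have h1 : VectorField.mlieBracket 𝓘(ℝ, E) X Y p =
        (mfderiv 𝓘(ℝ, E) 𝓘(ℝ, E) e p).inverse w := by
      have hs : e.symm ⁻¹' Set.univ ∩ Set.range 𝓘(ℝ, E) = Set.univ := by simp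
      rw [← VectorField.mlieBracketWithin_univ, VectorField.mlieBracketWithin_apply, hs, hw,
        ← VectorField.lieBracketWithin_univ]
    have hfe : (f : M → ℝ) =ᶠ[𝓝 p] (f ∘ e.symm) ∘ e := by
      filter_upwards [extChartAt_source_mem_nhds (I := 𝓘(ℝ, E)) p] with q hq
      exact congrArg f (e.left_inv hq).symm
    have h2 : mfderiv 𝓘(ℝ, E) 𝓘(ℝ, ℝ) f p =
        (mfderiv 𝓘(ℝ, E) 𝓘(ℝ, ℝ) (f ∘ e.symm) (e p)).comp (mfderiv 𝓘(ℝ, E) 𝓘(ℝ, E) e p) := by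
      rw [hfe.mfderiv_eq]
      exact mfderiv_comp p ((hf.differentiableAt (by simp)).mdifferentiableAt)
        (mdifferentiableAt_extChartAt (mem_chart_source E p))
    obtain ⟨L, hL⟩ : (mfderiv 𝓘(ℝ, E) 𝓘(ℝ, E) e p).IsInvertible :=
      isInvertible_mfderiv_extChartAt (mem_extChartAt_source (I := 𝓘(ℝ, E)) p)
    rw [h1, dirDeriv, h2, mfderiv_eq_fderiv, ← hL]
    rw [ContinuousLinearMap.inverse_equiv]
    exact congrArg (fderiv ℝ (f ∘ e.symm) (e p)) (L.apply_symm_apply w)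
  rw [hbr, VectorField.fderiv_apply_lieBracket hf (by simp; exact WithTop.coe_le_coe.2 (le_top : (2 : ℕ∞) ≤ ⊤)) hYd hXd,
    (hnear Y Yf hYf).fderiv_eq, (hnear X Xf hXf).fderiv_eq, hval X Yf, hval Y Xf]

theorem dirDeriv_congr {f : M → ℝ} {p q : M} (h : p = q) (v : E) :
    dirDeriv f p v = dirDeriv f q v := by
  subst h; rfl

/-- The section `[x, y]_{φ^*}` of `φ^!TM` exists. -/
theorem exists_bracket (φ : Diffeo E M) (x y : Sec E E (PullTangent φ)) :
    ∃ z : Sec E E (PullTangent φ), ∀ f : SmoothFun E M,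
      act z f = pull φ (act x ((pull φ).symm (act y ((pull φ).symm f))))
        - pull φ (act y ((pull φ).symm (act x ((pull φ).symm f)))) := by
  have hv : ∀ x : Sec E E (PullTangent φ), ContMDiff 𝓘(ℝ, E) (𝓘(ℝ, E).prod 𝓘(ℝ, E)) ∞
      (fun q => TotalSpace.mk' E (E := (TangentSpace 𝓘(ℝ, E) : M → Type _)) q
        (x (φ.symm q) : E)) := fun x => by
    refine ((contMDiff_pullTangent_iff.1 x.contMDiff).comp φ.symm.contMDiff).congr fun q => ?_
    exact (totalSpace_mk_congr (φ.apply_symm_apply q) _).symm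
  have hact : ∀ (x : Sec E E (PullTangent φ)) (f : SmoothFun E M) (q : M),
      (pull φ).symm (act x f) q = dirDeriv f q (x (φ.symm q) : E) :=
    fun x f q => dirDeriv_congr (φ.apply_symm_apply q) _
  have : IsManifold 𝓘(ℝ, E) (minSmoothness ℝ 2) M :=
    IsManifold.of_le (n := ∞) (by simp; exact WithTop.coe_le_coe.2 (le_top : (2 : ℕ∞) ≤ ⊤))
  have : IsManifold 𝓘(ℝ, E) (((⊤ : ℕ∞) : ℕ∞ω) + 1) M :=
    inferInstanceAs (IsManifold 𝓘(ℝ, E) ∞ M)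
  have hb := ContDiff.mlieBracket_vectorField (I := 𝓘(ℝ, E)) (m := ⊤) (n := ⊤) (hv x) (hv y)
    (by simp)
  let z' : Sec E E (PullTangent φ) :=
    ⟨fun m => VectorField.mlieBracket 𝓘(ℝ, E) (fun q => (x (φ.symm q) : E))
      (fun q => (y (φ.symm q) : E)) (φ m),
      contMDiff_pullTangent_iff.2 (hb.comp φ.contMDiff)⟩
  refine ⟨adSec φ z', fun f => ?_⟩
  rw [act_adSec, ← map_sub]
  congr 1
  generalize (pull φ).symm f = g
  ext m
  have h := mfderiv_mlieBracket (hv x) (hv y) g _ _ (hact x g) (hact y g) (φ m)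
  refine h.trans (congrArg₂ (· - ·) ?_ ?_)
  · exact congrArg (fun q => dirDeriv ((pull φ).symm (act y g)) (φ m) (x q : E))
      (φ.symm_apply_apply m)
  · exact congrArg (fun q => dirDeriv ((pull φ).symm (act x g)) (φ m) (y q : E))
      (φ.symm_apply_apply m)

end Bracket

end Tangent

section HomBundle

variable {E : Type*} [NormedAddCommGroup E] [NormedSpace ℝ E] [FiniteDimensional ℝ E]
  {M : Type*} [TopologicalSpace M] [ChartedSpace E M] [IsManifold 𝓘(ℝ, E) ∞ M] [T2Space M]
  {F : Type*} [NormedAddCommGroup F] [NormedSpace ℝ F]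
  {A : M → Type*} [∀ m, AddCommGroup (A m)] [∀ m, Module ℝ (A m)]
  [∀ m, TopologicalSpace (A m)] [TopologicalSpace (TotalSpace F A)]
  [FiberBundle F A] [VectorBundle ℝ F A]

theorem pair_add (ξ : Sec E (F →L[ℝ] ℝ) (DualBundle A)) (x y : Sec E F A) :
    pair ξ (x + y) = pair ξ x + pair ξ y := by
  ext m; exact map_add (ξ m) (x m) (y m)

theorem pair_neg (ξ : Sec E (F →L[ℝ] ℝ) (DualBundle A)) (x : Sec E F A) :
    pair ξ (-x) = -pair ξ x := by
  ext m; exact map_neg (ξ m) (x m)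

theorem pair_smul (ξ : Sec E (F →L[ℝ] ℝ) (DualBundle A)) (f : SmoothFun E M) (x : Sec E F A) :
    pair ξ (f • x) = f * pair ξ x := by
  ext m; exact map_smul (ξ m) (f m) (x m)

theorem add_pair (ξ η : Sec E (F →L[ℝ] ℝ) (DualBundle A)) (x : Sec E F A) :
    pair (ξ + η) x = pair ξ x + pair η x := rfl

theorem smul_pair (f : SmoothFun E M) (ξ : Sec E (F →L[ℝ] ℝ) (DualBundle A)) (x : Sec E F A) :
    pair (f • ξ) x = f * pair ξ x := rfl

theorem real_smul_pair (c : ℝ) (ξ : Sec E (F →L[ℝ] ℝ) (DualBundle A)) (x : Sec E F A) :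
    pair (c • ξ) x = c • pair ξ x := rfl

variable (F A) in
/-- An (invertible) Hom-bundle structure `(A, φ, φ_A)` on a vector bundle `A → M`: a linear
isomorphism `φ_A` of `Γ(A)` with `φ_A(f x) = φ^*(f) φ_A(x)`. -/
@[ext]
structure HomBundle (φ : Diffeo E M) where
  /-- The structure map `φ_A`. -/
  phi : Sec E F A ≃ₗ[ℝ] Sec E F A
  phi_smul : ∀ (f : SmoothFun E M) (x : Sec E F A), phi (f • x) = pull φ f • phi x

namespace HomBundle

variable {φ : Diffeo E M} (𝓑 : HomBundle F A φ)

theorem phi_symm_smul (f : SmoothFun E M) (x : Sec E F A) :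
    𝓑.phi.symm (f • x) = (pull φ).symm f • 𝓑.phi.symm x := by
  apply 𝓑.phi.injective
  rw [𝓑.phi_smul, LinearEquiv.apply_symm_apply, LinearEquiv.apply_symm_apply,
    AlgEquiv.apply_symm_apply]

variable [FiniteDimensional ℝ F] [ContMDiffVectorBundle ∞ F A 𝓘(ℝ, E)]

/-- The map `φ_A^†` on sections of `A^*`: `φ_A^†(ξ)(x) = φ^*(ξ(φ_A^{-1} x))`. -/
def dagger (ξ : Sec E (F →L[ℝ] ℝ) (DualBundle A)) : Sec E (F →L[ℝ] ℝ) (DualBundle A) :=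
  dualSection
    { toFun := fun x => pull φ (pair ξ (𝓑.phi.symm x))
      map_add' := fun x y => by rw [map_add, pair_add, map_add]
      map_smul' := fun f x => by
        rw [𝓑.phi_symm_smul, pair_smul, map_mul, AlgEquiv.apply_symm_apply]; rfl }

theorem pair_dagger (ξ : Sec E (F →L[ℝ] ℝ) (DualBundle A)) (x : Sec E F A) :
    pair (𝓑.dagger ξ) x = pull φ (pair ξ (𝓑.phi.symm x)) := pair_dualSection _ _

/-- The inverse of `φ_A^†`: `ξ ↦ (x ↦ (φ^*)^{-1}(ξ(φ_A x)))`. -/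
def daggerInv (ξ : Sec E (F →L[ℝ] ℝ) (DualBundle A)) : Sec E (F →L[ℝ] ℝ) (DualBundle A) :=
  dualSection
    { toFun := fun x => (pull φ).symm (pair ξ (𝓑.phi x))
      map_add' := fun x y => by rw [map_add, pair_add, map_add]
      map_smul' := fun f x => by
        rw [𝓑.phi_smul, pair_smul, map_mul, AlgEquiv.symm_apply_apply]; rfl }

theorem pair_daggerInv (ξ : Sec E (F →L[ℝ] ℝ) (DualBundle A)) (x : Sec E F A) :
    pair (𝓑.daggerInv ξ) x = (pull φ).symm (pair ξ (𝓑.phi x)) := pair_dualSection _ _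

/-- The dual Hom-bundle `(A^*, φ, φ_A^†)`. -/
def dual : HomBundle (F →L[ℝ] ℝ) (DualBundle A) φ where
  phi :=
    { toFun := 𝓑.dagger
      invFun := 𝓑.daggerInv
      map_add' := fun ξ η => pair_ext fun x => by
        rw [pair_dagger, add_pair, add_pair, map_add, pair_dagger, pair_dagger]
      map_smul' := fun c ξ => pair_ext fun x => by
        rw [pair_dagger, real_smul_pair, map_smul, ← pair_dagger]; rfl
      left_inv := fun ξ => pair_ext fun x => by
        rw [pair_daggerInv, pair_dagger, AlgEquiv.symm_apply_apply, LinearEquiv.symm_apply_apply]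
      right_inv := fun ξ => pair_ext fun x => by
        rw [pair_dagger, pair_daggerInv, AlgEquiv.apply_symm_apply,
          LinearEquiv.apply_symm_apply] }
  phi_smul f ξ := pair_ext fun x => by
    change pair (𝓑.dagger (f • ξ)) x = pair (pull φ f • 𝓑.dagger ξ) x
    rw [pair_dagger, smul_pair, map_mul, smul_pair, pair_dagger]

end HomBundle

/-- The Hom-bundle `(φ^!TM, φ, Ad_{φ^*})`. -/
def tangentHomBundle (φ : Diffeo E M) : HomBundle E (PullTangent φ) φ where
  phi :=
    { toFun := adSec φ
      invFun := adInvSec φ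
      map_add' := fun x y => act_injective fun f => by
        simp only [act_adSec, act_section_add, map_add]
      map_smul' := fun c x => act_injective fun f => by
        simp only [act_adSec, act_section_real_smul, map_smul, RingHom.id_apply]
      left_inv := fun x => act_injective fun f => by
        rw [act_adInvSec, act_adSec, AlgEquiv.symm_apply_apply, AlgEquiv.symm_apply_apply]
      right_inv := fun x => act_injective fun f => by
        rw [act_adSec, act_adInvSec, AlgEquiv.apply_symm_apply, AlgEquiv.apply_symm_apply] }
  phi_smul f x := act_injective fun g => by
    change act (adSec φ (f • x)) g = act (pull φ f • adSec φ x) g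
    rw [act_adSec, act_section_smul, map_mul, act_section_smul, act_adSec]

theorem act_tangentHomBundle_phi (φ : Diffeo E M) (x : Sec E E (PullTangent φ))
    (f : SmoothFun E M) :
    act ((tangentHomBundle φ).phi x) f = pull φ (act x ((pull φ).symm f)) := act_adSec φ x f

end HomBundle

section HomLieAlgebroid

variable {E : Type*} [NormedAddCommGroup E] [NormedSpace ℝ E] [FiniteDimensional ℝ E]
  {M : Type*} [TopologicalSpace M] [ChartedSpace E M] [IsManifold 𝓘(ℝ, E) ∞ M] [T2Space M]
  {F : Type*} [NormedAddCommGroup F] [NormedSpace ℝ F]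
  {A : M → Type*} [∀ m, AddCommGroup (A m)] [∀ m, Module ℝ (A m)]
  [∀ m, TopologicalSpace (A m)] [TopologicalSpace (TotalSpace F A)]
  [FiberBundle F A] [VectorBundle ℝ F A]

variable (F A) in
/-- Smooth bundle maps `A → φ^!TM` over the identity of `M`. -/
structure AnchorMap (φ : Diffeo E M) where
  /-- The map on fibres. -/
  toFun : ∀ m, A m →ₗ[ℝ] PullTangent φ m
  contMDiff : ContMDiff (𝓘(ℝ, E).prod 𝓘(ℝ, F)) (𝓘(ℝ, E).prod 𝓘(ℝ, E)) ∞
    (fun v : TotalSpace F A => TotalSpace.mk' E (E := PullTangent φ) v.proj (toFun v.proj v.snd))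

/-- The map induced on sections by a bundle map. -/
def AnchorMap.sec {φ : Diffeo E M} (a : AnchorMap F A φ) (x : Sec E F A) :
    Sec E E (PullTangent φ) :=
  ⟨fun m => a.toFun m (x m), a.contMDiff.comp x.contMDiff⟩

variable (F A) in
/-- A Hom-Lie algebroid `(A, φ, φ_A, [·,·]_A, a_A)`. -/
structure HomLieAlgebroid (φ : Diffeo E M) extends HomBundle F A φ where
  /-- The bracket on `Γ(A)`. -/
  bracket : Sec E F A →ₗ[ℝ] Sec E F A →ₗ[ℝ] Sec E F A
  bracket_skew : ∀ x y, bracket x y = -bracket y x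
  phi_bracket : ∀ x y, phi (bracket x y) = bracket (phi x) (phi y)
  hom_jacobi : ∀ x y z, bracket (phi x) (bracket y z) + bracket (phi y) (bracket z x)
    + bracket (phi z) (bracket x y) = 0
  /-- The anchor. -/
  anchor : AnchorMap F A φ
  leibniz : ∀ (x y : Sec E F A) (f : SmoothFun E M),
    bracket x (f • y) = pull φ f • bracket x y + act (anchor.sec (phi x)) f • phi y
  anchor_phi : ∀ (x : Sec E F A) (f : SmoothFun E M),
    act (anchor.sec (phi x)) (pull φ f) = pull φ (act (anchor.sec x) f)
  anchor_bracket : ∀ (x y : Sec E F A) (f : SmoothFun E M),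
    act (anchor.sec (bracket x y)) (pull φ f) =
      act (anchor.sec (phi x)) (act (anchor.sec y) f)
        - act (anchor.sec (phi y)) (act (anchor.sec x) f)

/-- The bracket
`[x, y]_{φ^*} = φ^* x (φ^*)^{-1} y (φ^*)^{-1} - φ^* y (φ^*)^{-1} x (φ^*)^{-1}` on `Γ(φ^!TM)`. -/
def tangentBracket (φ : Diffeo E M) (x y : Sec E E (PullTangent φ)) : Sec E E (PullTangent φ) :=
  haveI : CompleteSpace E := FiniteDimensional.complete ℝ E
  (exists_bracket φ x y).choose

theorem act_tangentBracket (φ : Diffeo E M) (x y : Sec E E (PullTangent φ))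
    (f : SmoothFun E M) :
    act (tangentBracket φ x y) f = pull φ (act x ((pull φ).symm (act y ((pull φ).symm f))))
      - pull φ (act y ((pull φ).symm (act x ((pull φ).symm f)))) :=
  haveI : CompleteSpace E := FiniteDimensional.complete ℝ E
  (exists_bracket φ x y).choose_spec f

theorem act_neg {φ : Diffeo E M} (x : Sec E E (PullTangent φ)) (f : SmoothFun E M) :
    act (-x) f = -act x f := by
  have h := act_section_real_smul (-1) x f
  simpa using h

theorem act_zero {φ : Diffeo E M} (f : SmoothFun E M) :
    act (0 : Sec E E (PullTangent φ)) f = 0 := by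
  have h := act_section_real_smul 0 (0 : Sec E E (PullTangent φ)) f
  simpa using h

theorem act_map_sub {φ : Diffeo E M} (x : Sec E E (PullTangent φ)) (f g : SmoothFun E M) :
    act x (f - g) = act x f - act x g := by
  have h := act_add x (f - g) g
  rw [sub_add_cancel] at h
  rw [h, add_sub_cancel_right]

theorem act_real_smul {φ : Diffeo E M} (c : ℝ) (x : Sec E E (PullTangent φ))
    (f : SmoothFun E M) : act x (c • f) = c • act x f := by
  ext m
  have hf : MDifferentiableAt 𝓘(ℝ, E) 𝓘(ℝ, ℝ) f (φ m) := f.mdifferentiableAt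
  exact congrArg (fun L => L (x m)) (const_smul_mfderiv hf c)

/-- The tangent Hom-Lie algebroid `(φ^!TM, φ, Ad_{φ^*}, [·,·]_{φ^*}, id)`. -/
def tangentHomLieAlgebroid (φ : Diffeo E M) : HomLieAlgebroid E (PullTangent φ) φ where
  toHomBundle := tangentHomBundle φ
  bracket := LinearMap.mk₂ ℝ (tangentBracket φ)
    (fun x y z => act_injective fun f => by
      simp only [act_tangentBracket, act_section_add, map_add, act_add]; abel)
    (fun c x y => act_injective fun f => by
      simp only [act_tangentBracket, act_section_real_smul, map_smul, act_real_smul, smul_sub])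
    (fun x y z => act_injective fun f => by
      simp only [act_tangentBracket, act_section_add, map_add, act_add]; abel)
    (fun c x y => act_injective fun f => by
      simp only [act_tangentBracket, act_section_real_smul, map_smul, act_real_smul, smul_sub])
  bracket_skew x y := act_injective fun f => by
    simp only [LinearMap.mk₂_apply, act_tangentBracket, act_neg, neg_sub]
  phi_bracket x y := act_injective fun f => by
    simp only [LinearMap.mk₂_apply, act_tangentBracket, act_tangentHomBundle_phi, map_sub,
      AlgEquiv.symm_apply_apply]
  hom_jacobi x y z := act_injective fun f => by
    simp only [LinearMap.mk₂_apply, act_tangentBracket, act_tangentHomBundle_phi, map_sub,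
      AlgEquiv.symm_apply_apply, act_section_add, act_map_sub, act_zero]
    abel
  anchor := ⟨fun _ => LinearMap.id, contMDiff_id⟩
  leibniz x y f := act_injective fun g => by
    change act (tangentBracket φ x (f • y)) g =
      act (pull φ f • tangentBracket φ x y + act ((tangentHomBundle φ).phi x) f •
        (tangentHomBundle φ).phi y) g
    simp only [act_tangentBracket, act_tangentHomBundle_phi, act_section_add, act_section_smul,
      map_mul, act_mul, map_add, AlgEquiv.apply_symm_apply]
    ring
  anchor_phi x f := by
    change act ((tangentHomBundle φ).phi x) (pull φ f) = pull φ (act x f)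
    rw [act_tangentHomBundle_phi, AlgEquiv.symm_apply_apply]
  anchor_bracket x y f := by
    change act (tangentBracket φ x y) (pull φ f) =
      act ((tangentHomBundle φ).phi x) (act y f) - act ((tangentHomBundle φ).phi y) (act x f)
    simp only [act_tangentBracket, act_tangentHomBundle_phi, AlgEquiv.symm_apply_apply]

end HomLieAlgebroid

section Calculus

variable {E : Type*} [NormedAddCommGroup E] [NormedSpace ℝ E] [FiniteDimensional ℝ E]
  {M : Type*} [TopologicalSpace M] [ChartedSpace E M] [IsManifold 𝓘(ℝ, E) ∞ M] [T2Space M]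
  {F : Type*} [NormedAddCommGroup F] [NormedSpace ℝ F]
  {A : M → Type*} [∀ m, AddCommGroup (A m)] [∀ m, Module ℝ (A m)]
  [∀ m, TopologicalSpace (A m)] [TopologicalSpace (TotalSpace F A)]
  [FiberBundle F A] [VectorBundle ℝ F A]

variable (E F A) in
/-- `2`-forms on `A`, as `C^∞(M)`-bilinear maps on `Γ(A)`. -/
abbrev TwoForm : Type _ :=
  Sec E F A →ₗ[SmoothFun E M] Sec E F A →ₗ[SmoothFun E M] SmoothFun E M

namespace HomLieAlgebroid

variable {φ : Diffeo E M} (𝒜 : HomLieAlgebroid F A φ)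

/-- `a_A(x)(f)`. -/
def derive (x : Sec E F A) (f : SmoothFun E M) : SmoothFun E M := act (𝒜.anchor.sec x) f

theorem derive_add_left (x y : Sec E F A) (f : SmoothFun E M) :
    𝒜.derive (x + y) f = 𝒜.derive x f + 𝒜.derive y f := by
  rw [derive, derive, derive, ← act_section_add]
  congr 1
  ext m
  exact map_add (𝒜.anchor.toFun m) (x m) (y m)

theorem derive_smul_left (g : SmoothFun E M) (x : Sec E F A) (f : SmoothFun E M) :
    𝒜.derive (g • x) f = g * 𝒜.derive x f := by
  rw [derive, derive, ← act_section_smul]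
  congr 1
  ext m
  exact map_smul (𝒜.anchor.toFun m) (g m) (x m)

theorem derive_add (x : Sec E F A) (f g : SmoothFun E M) :
    𝒜.derive x (f + g) = 𝒜.derive x f + 𝒜.derive x g := act_add _ _ _

theorem derive_mul (x : Sec E F A) (f g : SmoothFun E M) :
    𝒜.derive x (f * g) = 𝒜.derive x f * pull φ g + pull φ f * 𝒜.derive x g := act_mul _ _ _

variable [FiniteDimensional ℝ F] [ContMDiffVectorBundle ∞ F A 𝓘(ℝ, E)]

/-- The differential of a function: `df(x) = a_A(x)(f)`. -/
def d0 (f : SmoothFun E M) : Sec E (F →L[ℝ] ℝ) (DualBundle A) :=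
  dualSection
    { toFun := fun x => 𝒜.derive x f
      map_add' := fun x y => 𝒜.derive_add_left x y f
      map_smul' := fun g x => 𝒜.derive_smul_left g x f }

/-- The value on `x`, `y` of the differential of a `1`-form `ξ`:
`dξ(x, y) = a_A(x)(ξ(φ_A^{-1} y)) - a_A(y)(ξ(φ_A^{-1} x))
- φ_A^†(ξ)([φ_A^{-1} x, φ_A^{-1} y])`. -/
def d1Val (ξ : Sec E (F →L[ℝ] ℝ) (DualBundle A)) (x y : Sec E F A) : SmoothFun E M :=
  𝒜.derive x (pair ξ (𝒜.phi.symm y)) - 𝒜.derive y (pair ξ (𝒜.phi.symm x))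
    - pair (𝒜.dual.phi ξ) (𝒜.bracket (𝒜.phi.symm x) (𝒜.phi.symm y))

theorem d1Val_swap (ξ : Sec E (F →L[ℝ] ℝ) (DualBundle A)) (x y : Sec E F A) :
    𝒜.d1Val ξ x y = -𝒜.d1Val ξ y x := by
  rw [d1Val, d1Val, 𝒜.bracket_skew (𝒜.phi.symm x), pair_neg]
  ring

theorem d1Val_add (ξ : Sec E (F →L[ℝ] ℝ) (DualBundle A)) (x y z : Sec E F A) :
    𝒜.d1Val ξ x (y + z) = 𝒜.d1Val ξ x y + 𝒜.d1Val ξ x z := by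
  simp only [d1Val, map_add, pair_add, derive_add, derive_add_left]
  ring

theorem d1Val_smul (ξ : Sec E (F →L[ℝ] ℝ) (DualBundle A)) (f : SmoothFun E M)
    (x y : Sec E F A) : 𝒜.d1Val ξ x (f • y) = f * 𝒜.d1Val ξ x y := by
  have h : pair (𝒜.dual.phi ξ) y = pull φ (pair ξ (𝒜.phi.symm y)) := 𝒜.pair_dagger ξ y
  rw [d1Val, d1Val, 𝒜.phi_symm_smul, 𝒜.leibniz, pair_add, pair_smul, pair_smul, pair_smul,
    derive_mul, derive_smul_left, AlgEquiv.apply_symm_apply, LinearEquiv.apply_symm_apply,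
    LinearEquiv.apply_symm_apply, h, derive]
  simp only [derive]
  ring

/-- The differential of a `1`-form. -/
def d1 (ξ : Sec E (F →L[ℝ] ℝ) (DualBundle A)) : TwoForm E F A :=
  LinearMap.mk₂ (SmoothFun E M) (𝒜.d1Val ξ)
    (fun x y z => by
      rw [d1Val_swap, d1Val_add, neg_add, ← d1Val_swap, ← d1Val_swap])
    (fun f x y => by
      rw [d1Val_swap, d1Val_smul, ← mul_neg, ← d1Val_swap]; rfl)
    (fun x y z => 𝒜.d1Val_add ξ x y z)
    (fun f x y => 𝒜.d1Val_smul ξ f x y)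

end HomLieAlgebroid

namespace HomBundle

variable {φ : Diffeo E M} (𝓑 : HomBundle F A φ)

/-- `φ_A^†` on `2`-forms: `φ_A^†(Ξ)(x, y) = φ^*(Ξ(φ_A^{-1} x, φ_A^{-1} y))`. -/
def daggerTwo (Ξ : TwoForm E F A) : TwoForm E F A :=
  LinearMap.mk₂ (SmoothFun E M) (fun x y => pull φ (Ξ (𝓑.phi.symm x) (𝓑.phi.symm y)))
    (fun x y z => by simp only [map_add, LinearMap.add_apply])
    (fun f x y => by
      simp only [phi_symm_smul, map_smul, LinearMap.smul_apply, smul_eq_mul, map_mul,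
        AlgEquiv.apply_symm_apply])
    (fun x y z => by simp only [map_add])
    (fun f x y => by
      simp only [phi_symm_smul, map_smul, smul_eq_mul, map_mul, AlgEquiv.apply_symm_apply])

variable [FiniteDimensional ℝ F] [ContMDiffVectorBundle ∞ F A 𝓘(ℝ, E)]

/-- Contraction of a `1`-form: `i_x ξ = φ_A^†(ξ)(φ_A x)`. -/
def contrOne (x : Sec E F A) (ξ : Sec E (F →L[ℝ] ℝ) (DualBundle A)) : SmoothFun E M :=
  pair (𝓑.dual.phi ξ) (𝓑.phi x)

/-- Contraction of a `2`-form: `(i_x Ξ)(y) = φ_A^†(Ξ)(φ_A x, y)`. -/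
def contrTwo (x : Sec E F A) (Ξ : TwoForm E F A) : Sec E (F →L[ℝ] ℝ) (DualBundle A) :=
  dualSection (𝓑.daggerTwo Ξ (𝓑.phi x))

end HomBundle

variable [FiniteDimensional ℝ F] [ContMDiffVectorBundle ∞ F A 𝓘(ℝ, E)]

/-- The Lie derivative `L_x` on `1`-forms, determined by
`L_x ∘ φ_A^† = i_x ∘ d + d ∘ i_{φ_A^{-1} x}`. -/
def HomLieAlgebroid.lieDeriv {φ : Diffeo E M} (𝒜 : HomLieAlgebroid F A φ) (x : Sec E F A)
    (η : Sec E (F →L[ℝ] ℝ) (DualBundle A)) : Sec E (F →L[ℝ] ℝ) (DualBundle A) :=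
  𝒜.contrTwo x (𝒜.d1 (𝒜.dual.phi.symm η))
    + 𝒜.d0 (𝒜.contrOne (𝒜.phi.symm x) (𝒜.dual.phi.symm η))

end Calculus

section Bivectors

section Linear

variable {V : Type*} [AddCommGroup V] [Module ℝ V]

/-- The value `P(ξ, η)` of `P ∈ ⋀²V` on covectors; `(x ∧ y)(ξ, η) = ξ(x) η(y) - ξ(y) η(x)`. -/
def bivectorEval (P : ⋀[ℝ]^2 V) (ξ η : Module.Dual ℝ V) : ℝ :=
  exteriorPower.alternatingMapToDual ℝ V 2 ![ξ, η] P

theorem bivectorEval_ιMulti (x y : V) (ξ η : Module.Dual ℝ V) :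
    bivectorEval (exteriorPower.ιMulti ℝ 2 ![x, y]) ξ η = ξ x * η y - ξ y * η x := by
  simp [bivectorEval, Matrix.det_fin_two]; ring

theorem bivectorEval_swap (P : ⋀[ℝ]^2 V) (ξ η : Module.Dual ℝ V) :
    bivectorEval P ξ η = -bivectorEval P η ξ := by
  have h := (exteriorPower.alternatingMapToDual ℝ V 2).map_swap ![η, ξ]
    (i := 0) (j := 1) (by decide)
  have h2 : (![η, ξ] ∘ Equiv.swap 0 1 : Fin 2 → Module.Dual ℝ V) = ![ξ, η] := by
    ext i; fin_cases i <;> simp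
  rw [h2] at h
  exact congrArg (fun L => L P) h

theorem bivectorEval_add_left (P : ⋀[ℝ]^2 V) (ξ ξ' η : Module.Dual ℝ V) :
    bivectorEval P (ξ + ξ') η = bivectorEval P ξ η + bivectorEval P ξ' η :=
  congrArg (fun L => L P)
    ((exteriorPower.alternatingMapToDual ℝ V 2).map_vecCons_add ![η] ξ ξ')

theorem bivectorEval_smul_left (P : ⋀[ℝ]^2 V) (c : ℝ) (ξ η : Module.Dual ℝ V) :
    bivectorEval P (c • ξ) η = c * bivectorEval P ξ η :=
  congrArg (fun L => L P)
    ((exteriorPower.alternatingMapToDual ℝ V 2).map_vecCons_smul ![η] c ξ)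

/-- The bilinear form on `V^*` given by `P ∈ ⋀²V`. -/
def bivectorForm (P : ⋀[ℝ]^2 V) : Module.Dual ℝ V →ₗ[ℝ] Module.Dual ℝ (Module.Dual ℝ V) :=
  LinearMap.mk₂ ℝ (bivectorEval P) (bivectorEval_add_left P) (bivectorEval_smul_left P)
    (fun ξ η η' => by
      rw [bivectorEval_swap, bivectorEval_add_left, neg_add, ← bivectorEval_swap,
        ← bivectorEval_swap])
    (fun c ξ η => by
      rw [bivectorEval_swap, bivectorEval_smul_left, ← mul_neg, ← bivectorEval_swap]; rfl)

/-- The map `P^♯ : V^* → V` with `η(P^♯ ξ) = P(ξ, η)`. -/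
def sharp [FiniteDimensional ℝ V] (P : ⋀[ℝ]^2 V) : Module.Dual ℝ V →ₗ[ℝ] V :=
  (Module.evalEquiv ℝ V).symm.toLinearMap ∘ₗ bivectorForm P

theorem apply_sharp [FiniteDimensional ℝ V] (P : ⋀[ℝ]^2 V) (ξ η : Module.Dual ℝ V) :
    η (sharp P ξ) = bivectorEval P ξ η := by
  change η ((Module.evalEquiv ℝ V).symm (bivectorForm P ξ)) = _
  rw [Module.apply_evalEquiv_symm_apply]
  rfl

end Linear

variable {E : Type*} [NormedAddCommGroup E] [NormedSpace ℝ E] [FiniteDimensional ℝ E]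
  {M : Type*} [TopologicalSpace M] [ChartedSpace E M] [IsManifold 𝓘(ℝ, E) ∞ M] [T2Space M]
  {F : Type*} [NormedAddCommGroup F] [NormedSpace ℝ F]
  {A : M → Type*} [∀ m, AddCommGroup (A m)] [∀ m, Module ℝ (A m)]
  [∀ m, TopologicalSpace (A m)] [TopologicalSpace (TotalSpace F A)]
  [FiberBundle F A] [VectorBundle ℝ F A]

variable (E F A) in
/-- Smooth sections of `⋀²A`: fields of elements of `⋀²A_m` that are smooth when evaluated on
smooth sections of `A^*`. -/
structure Bisection where
  /-- The value at a point. -/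
  val : ∀ m, ⋀[ℝ]^2 (A m)
  contMDiff_eval : ∀ ξ η : Sec E (F →L[ℝ] ℝ) (DualBundle A),
    ContMDiff 𝓘(ℝ, E) 𝓘(ℝ, ℝ) ∞ (fun m => bivectorEval (val m) (ξ m) (η m))

namespace Bisection

/-- The function `P(ξ, η)`. -/
def eval (P : Bisection E F A) (ξ η : Sec E (F →L[ℝ] ℝ) (DualBundle A)) : SmoothFun E M :=
  ⟨_, P.contMDiff_eval ξ η⟩

variable [FiniteDimensional ℝ F] [ContMDiffVectorBundle ∞ F A 𝓘(ℝ, E)]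
  [∀ m, FiniteDimensional ℝ (A m)]

/-- The section `P^♯(ξ)`, with `η(P^♯(ξ)) = P(ξ, η)`. -/
def sharpSec (P : Bisection E F A) (ξ : Sec E (F →L[ℝ] ℝ) (DualBundle A)) : Sec E F A :=
  ⟨fun m => sharp (P.val m) (ξ m), contMDiff_of_pair fun η =>
    (P.contMDiff_eval ξ η).congr fun m => apply_sharp (P.val m) (ξ m) (η m)⟩

theorem pair_sharpSec (P : Bisection E F A) (ξ η : Sec E (F →L[ℝ] ℝ) (DualBundle A)) :
    pair η (P.sharpSec ξ) = P.eval ξ η := by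
  ext m
  exact apply_sharp (P.val m) (ξ m) (η m)

end Bisection

/-- `φ_A P = Q` for sections `P`, `Q` of `⋀²A`, where `φ_A(x ∧ y) = φ_A(x) ∧ φ_A(y)`. It is
computed from an expression of `P` as a finite sum of products of global sections; such an
expression exists (on a second countable manifold), and the value does not depend on it. -/
def HomBundle.IsPhiTwo {φ : Diffeo E M} (𝓑 : HomBundle F A φ) (P Q : Bisection E F A) : Prop :=
  ∃ (k : ℕ) (x y : Fin k → Sec E F A),
    (∀ m, P.val m = ∑ i, exteriorPower.ιMulti ℝ 2 ![x i m, y i m]) ∧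
    (∀ m, Q.val m = ∑ i, exteriorPower.ιMulti ℝ 2 ![𝓑.phi (x i) m, 𝓑.phi (y i) m])

/-- The Hom-Schouten bracket of `x₁ ∧ x₂` and `y₁ ∧ y₂`: the section
`∑_{i, j} (-1)^{i + j} [x_i, y_j] ∧ φ_A(x_{i'}) ∧ φ_A(y_{j'})` of `⋀³A`,
where `i'` and `j'` are the indices other than `i` and `j`. -/
def HomLieAlgebroid.schoutenTerm {φ : Diffeo E M} (𝒜 : HomLieAlgebroid F A φ)
    (x₁ x₂ y₁ y₂ : Sec E F A) (m : M) : ⋀[ℝ]^3 (A m) :=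
  exteriorPower.ιMulti ℝ 3 ![𝒜.bracket x₁ y₁ m, 𝒜.phi x₂ m, 𝒜.phi y₂ m]
    - exteriorPower.ιMulti ℝ 3 ![𝒜.bracket x₁ y₂ m, 𝒜.phi x₂ m, 𝒜.phi y₁ m]
    - exteriorPower.ιMulti ℝ 3 ![𝒜.bracket x₂ y₁ m, 𝒜.phi x₁ m, 𝒜.phi y₂ m]
    + exteriorPower.ιMulti ℝ 3 ![𝒜.bracket x₂ y₂ m, 𝒜.phi x₁ m, 𝒜.phi y₁ m]

/-- `T` is the Hom-Schouten bracket `⟦P, Q⟧` of the sections `P`, `Q` of `⋀²A`. It is computed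
from expressions of `P` and `Q` as finite sums of products of global sections; such expressions
exist (on a second countable manifold), and the value does not depend on them. -/
def HomLieAlgebroid.IsSchouten {φ : Diffeo E M} (𝒜 : HomLieAlgebroid F A φ)
    (P Q : Bisection E F A) (T : ∀ m, ⋀[ℝ]^3 (A m)) : Prop :=
  ∃ (k l : ℕ) (x₁ x₂ : Fin k → Sec E F A) (y₁ y₂ : Fin l → Sec E F A),
    (∀ m, P.val m = ∑ i, exteriorPower.ιMulti ℝ 2 ![x₁ i m, x₂ i m]) ∧
    (∀ m, Q.val m = ∑ j, exteriorPower.ιMulti ℝ 2 ![y₁ j m, y₂ j m]) ∧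
    (∀ m, T m = ∑ i, ∑ j, 𝒜.schoutenTerm (x₁ i) (x₂ i) (y₁ j) (y₂ j) m)

instance PullTangent.instFiniteDimensional (φ : Diffeo E M) (m : M) :
    FiniteDimensional ℝ (PullTangent φ m) :=
  inferInstanceAs (FiniteDimensional ℝ E)

/-- `(M, φ, P)` is a Hom-Poisson manifold: `P` is a section of `⋀²φ^!TM` with
`⟦P, P⟧_{φ^*} = 0` and `Ad_{φ^*}(P) = P`. -/
def IsHomPoisson (φ : Diffeo E M) (P : Bisection E E (PullTangent φ)) : Prop :=
  (tangentHomLieAlgebroid φ).IsSchouten P P (fun _ => 0) ∧ (tangentHomBundle φ).IsPhiTwo P P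

/-- The section
`[ξ, η]_P = L_{P^♯ ξ} η - L_{P^♯ η} ξ - d(P(ξ, η))` of `φ^!T^*M`, where `L` and `d` are those of
the tangent Hom-Lie algebroid. -/
def cotangentBracket (φ : Diffeo E M) (P : Bisection E E (PullTangent φ))
    (ξ η : Sec E (E →L[ℝ] ℝ) (PullCotangent φ)) : Sec E (E →L[ℝ] ℝ) (PullCotangent φ) :=
  (tangentHomLieAlgebroid φ).lieDeriv (P.sharpSec ξ) η
    - (tangentHomLieAlgebroid φ).lieDeriv (P.sharpSec η) ξ
    - (tangentHomLieAlgebroid φ).d0 (P.eval ξ η)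

end Bivectors

end HomPoisson

end

open HomPoisson

/-! The twist by `φ` can be removed. A section `x` of `φ^!TM` is the same as the vector field `X =
(φ^*)⁻¹ ∘ x` on `M`, and a section of `φ^!T^*M` is an ordinary `1`-form. In these terms `[x,
y]_{φ^*}` is `Ad_{φ^*}` applied to the Lie bracket of vector fields (`phi_vecLie`, `vecAct_vecLie`),
the Lie derivative is `Ad^†` of the usual one (`vecPair_lieDeriv`), and `[ξ, η]_{π^♯}` is `Ad^†` of
the classical Koszul bracket of `1`-forms (`vecPair_cotangentBracket`). The Hom-Poisson conditions
say that `π` is a Poisson bivector invariant under `φ`, and the theorem becomes the classical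
construction of the cotangent Lie algebroid, twisted by an automorphism.

The classical core is that `π^♯` intertwines the Koszul and Lie brackets. The obstruction `ζ([π^♯ξ,
π^♯η] - π^♯[ξ, η])` is quadratic in `π`. Its polarization is additive in both slots, and its
symmetrization on `a ∧ b` and `c ∧ d` is the untwisted Schouten bracket (`koszulDefect_sharpWedge`).
Hence twice the obstruction is a value of `⟦π, π⟧ = 0` (`koszulDefect_sharpSec`), which gives
`sharpSec_cotangentBracket`.

The rest follows formally. Invariance of `π` makes `π^♯` commute with the structure maps
(`sharpSec_dual_phi`), hence the bracket is compatible with `Ad^†`. The Leibniz rule uses only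
skew-symmetry and this equivariance. In the Hom-Jacobi sum, the morphism property lets the
vector-field commutators cancel, and what remains is `-2` times the derivative of the vanishing
obstruction (`cotangentBracket_jacobi`). The anchor axioms are those of the tangent algebroid,
transported along `π^♯`. -/

namespace HomPoisson

/-! ### Untwisting: sections of `φ^!TM` and `φ^!T^*M` as vector fields and `1`-forms on `M`. -/

section Untwisted

variable {E : Type*} [NormedAddCommGroup E] [NormedSpace ℝ E] [FiniteDimensional ℝ E]
  {M : Type*} [TopologicalSpace M] [ChartedSpace E M] [IsManifold 𝓘(ℝ, E) ∞ M] [T2Space M]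
  {φ : Diffeo E M}

/-- The derivation `(φ^*)^{-1} ∘ x` of `C^∞(M)`, i.e. the vector field on `M` given by `x`. -/
noncomputable def vecAct (x : Sec E E (PullTangent φ)) (f : SmoothFun E M) : SmoothFun E M :=
  (pull φ).symm (act x f)

/-- The section of `φ^!TM` given by the Lie bracket of the vector fields of `x` and `y`. -/
noncomputable def vecLie (x y : Sec E E (PullTangent φ)) : Sec E E (PullTangent φ) :=
  (tangentHomBundle φ).phi.symm (tangentBracket φ x y)

/-- The pairing of the `1`-form and the vector field on `M` given by `ξ` and `x`. -/
noncomputable def vecPair (ξ : Sec E (E →L[ℝ] ℝ) (PullCotangent φ))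
    (x : Sec E E (PullTangent φ)) : SmoothFun E M :=
  (pull φ).symm (pair ξ x)

theorem act_eq_pull_vecAct (x : Sec E E (PullTangent φ)) (f : SmoothFun E M) :
    act x f = pull φ (vecAct x f) := ((pull φ).apply_symm_apply _).symm

theorem pair_eq_pull_vecPair (ξ : Sec E (E →L[ℝ] ℝ) (PullCotangent φ))
    (x : Sec E E (PullTangent φ)) : pair ξ x = pull φ (vecPair ξ x) :=
  ((pull φ).apply_symm_apply _).symm

theorem vecAct_injective {x y : Sec E E (PullTangent φ)} (h : ∀ f, vecAct x f = vecAct y f) :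
    x = y :=
  act_injective fun f => (pull φ).symm.injective (h f)

theorem vecAct_add_left (x y : Sec E E (PullTangent φ)) (f : SmoothFun E M) :
    vecAct (x + y) f = vecAct x f + vecAct y f := by
  simp only [vecAct, act_section_add, map_add]

theorem vecAct_neg_left (x : Sec E E (PullTangent φ)) (f : SmoothFun E M) :
    vecAct (-x) f = -vecAct x f := by
  simp only [vecAct, act_neg, map_neg]

theorem vecAct_sub_left (x y : Sec E E (PullTangent φ)) (f : SmoothFun E M) :
    vecAct (x - y) f = vecAct x f - vecAct y f := by
  rw [sub_eq_add_neg, vecAct_add_left, vecAct_neg_left, sub_eq_add_neg]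

/-- The vector `x m` sits over `φ m`, so multiplying the vector field by `g` means multiplying the
section by `pull φ g`. All function coefficients below carry a `pull φ` for this reason. -/
theorem vecAct_pull_smul (g : SmoothFun E M) (x : Sec E E (PullTangent φ)) (f : SmoothFun E M) :
    vecAct (pull φ g • x) f = g * vecAct x f := by
  simp only [vecAct, act_section_smul, map_mul, AlgEquiv.symm_apply_apply]

theorem vecAct_add (x : Sec E E (PullTangent φ)) (f g : SmoothFun E M) :
    vecAct x (f + g) = vecAct x f + vecAct x g := by
  simp only [vecAct, act_add, map_add]

theorem vecAct_sub (x : Sec E E (PullTangent φ)) (f g : SmoothFun E M) :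
    vecAct x (f - g) = vecAct x f - vecAct x g := by
  simp only [vecAct, act_map_sub, map_sub]

theorem vecAct_neg (x : Sec E E (PullTangent φ)) (f : SmoothFun E M) :
    vecAct x (-f) = -vecAct x f := by
  have h := vecAct_sub x f (f + f)
  rw [vecAct_add, sub_add_cancel_left, sub_add_cancel_left] at h
  exact h

theorem vecAct_mul (x : Sec E E (PullTangent φ)) (f g : SmoothFun E M) :
    vecAct x (f * g) = vecAct x f * g + f * vecAct x g := by
  simp only [vecAct, act_mul, map_add, map_mul, AlgEquiv.symm_apply_apply]

theorem vecAct_phi (x : Sec E E (PullTangent φ)) (f : SmoothFun E M) :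
    vecAct ((tangentHomBundle φ).phi x) f = pull φ (vecAct x ((pull φ).symm f)) := by
  simp only [vecAct, act_tangentHomBundle_phi, AlgEquiv.symm_apply_apply,
    AlgEquiv.apply_symm_apply]

theorem vecAct_phi_pull (x : Sec E E (PullTangent φ)) (f : SmoothFun E M) :
    vecAct ((tangentHomBundle φ).phi x) (pull φ f) = pull φ (vecAct x f) := by
  rw [vecAct_phi, AlgEquiv.symm_apply_apply]

theorem phi_vecLie (x y : Sec E E (PullTangent φ)) :
    (tangentHomBundle φ).phi (vecLie x y) = tangentBracket φ x y :=
  LinearEquiv.apply_symm_apply _ _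

/-- Substituting `x = φ^* ∘ X` and `y = φ^* ∘ Y` in the definition of `[x, y]_{φ^*}` gives `φ^* ∘
φ^* ∘ (XY - YX) ∘ (φ^*)⁻¹`, which is the section `Ad_{φ^*}` of the commutator. -/
theorem vecAct_vecLie (x y : Sec E E (PullTangent φ)) (f : SmoothFun E M) :
    vecAct (vecLie x y) f = vecAct x (vecAct y f) - vecAct y (vecAct x f) := by
  apply (pull φ).injective
  rw [← vecAct_phi_pull, phi_vecLie, vecAct, act_tangentBracket]
  simp only [vecAct, map_sub, AlgEquiv.symm_apply_apply, AlgEquiv.apply_symm_apply]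

theorem vecLie_swap (x y : Sec E E (PullTangent φ)) : vecLie x y = -vecLie y x :=
  vecAct_injective fun f => by simp only [vecAct_vecLie, vecAct_neg_left, neg_sub]

theorem vecLie_add_left (x y z : Sec E E (PullTangent φ)) :
    vecLie (x + y) z = vecLie x z + vecLie y z :=
  vecAct_injective fun f => by simp only [vecAct_vecLie, vecAct_add_left, vecAct_add]; ring

theorem vecLie_add_right (x y z : Sec E E (PullTangent φ)) :
    vecLie x (y + z) = vecLie x y + vecLie x z :=
  vecAct_injective fun f => by simp only [vecAct_vecLie, vecAct_add_left, vecAct_add]; ring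

theorem vecLie_sub_left (x y z : Sec E E (PullTangent φ)) :
    vecLie (x - y) z = vecLie x z - vecLie y z :=
  vecAct_injective fun f => by simp only [vecAct_vecLie, vecAct_sub_left, vecAct_sub]; ring

theorem vecLie_sub_right (x y z : Sec E E (PullTangent φ)) :
    vecLie x (y - z) = vecLie x y - vecLie x z :=
  vecAct_injective fun f => by simp only [vecAct_vecLie, vecAct_sub_left, vecAct_sub]; ring

theorem vecLie_pull_smul_right (f : SmoothFun E M) (x y : Sec E E (PullTangent φ)) :
    vecLie x (pull φ f • y) = pull φ f • vecLie x y + pull φ (vecAct x f) • y :=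
  vecAct_injective fun g => by
    simp only [vecAct_vecLie, vecAct_add_left, vecAct_pull_smul, vecAct_mul]; ring

theorem vecLie_pull_smul_left (f : SmoothFun E M) (x y : Sec E E (PullTangent φ)) :
    vecLie (pull φ f • x) y = pull φ f • vecLie x y - pull φ (vecAct y f) • x :=
  vecAct_injective fun g => by
    simp only [vecAct_vecLie, vecAct_sub_left, vecAct_pull_smul, vecAct_mul]; ring

/-- The untwisted bracket is a commutator of operators, so it satisfies the ordinary Jacobi identity
with no structure map. -/
theorem vecLie_vecLie_left (x y z : Sec E E (PullTangent φ)) :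
    vecLie (vecLie x y) z = vecLie x (vecLie y z) - vecLie y (vecLie x z) :=
  vecAct_injective fun f => by simp only [vecAct_vecLie, vecAct_sub_left, vecAct_sub]; ring

theorem phi_vecLie_eq (x y : Sec E E (PullTangent φ)) :
    (tangentHomBundle φ).phi (vecLie x y) =
      vecLie ((tangentHomBundle φ).phi x) ((tangentHomBundle φ).phi y) :=
  vecAct_injective fun f => by
    simp only [vecAct_vecLie, vecAct_phi, map_sub, AlgEquiv.symm_apply_apply]

theorem vecPair_add_left (ξ η : Sec E (E →L[ℝ] ℝ) (PullCotangent φ))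
    (x : Sec E E (PullTangent φ)) : vecPair (ξ + η) x = vecPair ξ x + vecPair η x := by
  simp only [vecPair, add_pair, map_add]

theorem vecPair_add (ξ : Sec E (E →L[ℝ] ℝ) (PullCotangent φ)) (x y : Sec E E (PullTangent φ)) :
    vecPair ξ (x + y) = vecPair ξ x + vecPair ξ y := by
  simp only [vecPair, pair_add, map_add]

theorem vecPair_neg (ξ : Sec E (E →L[ℝ] ℝ) (PullCotangent φ)) (x : Sec E E (PullTangent φ)) :
    vecPair ξ (-x) = -vecPair ξ x := by
  simp only [vecPair, pair_neg, map_neg]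

theorem vecPair_sub (ξ : Sec E (E →L[ℝ] ℝ) (PullCotangent φ)) (x y : Sec E E (PullTangent φ)) :
    vecPair ξ (x - y) = vecPair ξ x - vecPair ξ y := by
  rw [sub_eq_add_neg, vecPair_add, vecPair_neg, sub_eq_add_neg]

theorem vecPair_pull_smul (ξ : Sec E (E →L[ℝ] ℝ) (PullCotangent φ)) (f : SmoothFun E M)
    (x : Sec E E (PullTangent φ)) : vecPair ξ (pull φ f • x) = f * vecPair ξ x := by
  simp only [vecPair, pair_smul, map_mul, AlgEquiv.symm_apply_apply]

theorem vecPair_ext {ξ η : Sec E (E →L[ℝ] ℝ) (PullCotangent φ)}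
    (h : ∀ x, vecPair ξ x = vecPair η x) : ξ = η :=
  pair_ext fun x => (pull φ).symm.injective (h x)

theorem vecPair_dual_phi (ξ : Sec E (E →L[ℝ] ℝ) (PullCotangent φ))
    (x : Sec E E (PullTangent φ)) :
    vecPair ((tangentHomBundle φ).dual.phi ξ) x =
      pull φ (vecPair ξ ((tangentHomBundle φ).phi.symm x)) := by
  have h := (tangentHomBundle φ).pair_dagger ξ x
  exact (congrArg (pull φ).symm h).trans (by
    rw [vecPair, AlgEquiv.symm_apply_apply, AlgEquiv.apply_symm_apply])

theorem vecPair_dual_phi_phi (ξ : Sec E (E →L[ℝ] ℝ) (PullCotangent φ))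
    (x : Sec E E (PullTangent φ)) :
    vecPair ((tangentHomBundle φ).dual.phi ξ) ((tangentHomBundle φ).phi x) =
      pull φ (vecPair ξ x) := by
  rw [vecPair_dual_phi, LinearEquiv.symm_apply_apply]

theorem vecPair_dual_phi_symm (ξ : Sec E (E →L[ℝ] ℝ) (PullCotangent φ))
    (x : Sec E E (PullTangent φ)) :
    vecPair ((tangentHomBundle φ).dual.phi.symm ξ) x =
      (pull φ).symm (vecPair ξ ((tangentHomBundle φ).phi x)) := by
  conv_rhs => rw [← (tangentHomBundle φ).dual.phi.apply_symm_apply ξ]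
  rw [vecPair_dual_phi_phi, AlgEquiv.symm_apply_apply]

theorem vecPair_d0 (f : SmoothFun E M) (x : Sec E E (PullTangent φ)) :
    vecPair ((tangentHomLieAlgebroid φ).d0 f) x = vecAct x f :=
  congrArg (pull φ).symm (pair_dualSection _ x)

/-- Sections of `φ^!TM` are separated by sections of `φ^!T^*M`. -/
theorem eq_of_forall_vecPair {x y : Sec E E (PullTangent φ)}
    (h : ∀ ζ : Sec E (E →L[ℝ] ℝ) (PullCotangent φ), vecPair ζ x = vecPair ζ y) : x = y :=
  vecAct_injective fun f => by rw [← vecPair_d0, ← vecPair_d0, h]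

/-- Up to `Ad^†`, the Lie derivative is that of the `1`-form `η` along the vector field `x`. -/
theorem vecPair_lieDeriv (x : Sec E E (PullTangent φ))
    (η : Sec E (E →L[ℝ] ℝ) (PullCotangent φ)) (y : Sec E E (PullTangent φ)) :
    vecPair ((tangentHomLieAlgebroid φ).lieDeriv x η) ((tangentHomBundle φ).phi y) =
      pull φ (vecAct x (vecPair η y) - vecPair η (vecLie x y)) := by
  -- Cartan's formula in untwisted form: `h1` and `h2` compute `i_x d`, `h3` computes `d i_x`, and
  -- the term `y(η(x))` of `h3` cancels the one in `h2`.
  have h1 : vecPair ((tangentHomLieAlgebroid φ).contrTwo x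
      ((tangentHomLieAlgebroid φ).d1 ((tangentHomBundle φ).dual.phi.symm η)))
        ((tangentHomBundle φ).phi y) =
      (tangentHomLieAlgebroid φ).d1Val ((tangentHomBundle φ).dual.phi.symm η) x y := by
    refine (congrArg (pull φ).symm (pair_dualSection _ _)).trans ?_
    change (pull φ).symm (pull φ ((tangentHomLieAlgebroid φ).d1Val
      ((tangentHomBundle φ).dual.phi.symm η)
      ((tangentHomBundle φ).phi.symm ((tangentHomBundle φ).phi x))
      ((tangentHomBundle φ).phi.symm ((tangentHomBundle φ).phi y)))) = _
    rw [AlgEquiv.symm_apply_apply, LinearEquiv.symm_apply_apply, LinearEquiv.symm_apply_apply]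
  have h2 : (tangentHomLieAlgebroid φ).d1Val ((tangentHomBundle φ).dual.phi.symm η) x y =
      pull φ (vecAct x (vecPair η y)) - pull φ (vecAct y (vecPair η x))
        - pull φ (vecPair η (vecLie x y)) := by
    change act x (pair ((tangentHomBundle φ).dual.phi.symm η) ((tangentHomBundle φ).phi.symm y))
      - act y (pair ((tangentHomBundle φ).dual.phi.symm η) ((tangentHomBundle φ).phi.symm x))
      - pair ((tangentHomBundle φ).dual.phi ((tangentHomBundle φ).dual.phi.symm η))
        (tangentBracket φ ((tangentHomBundle φ).phi.symm x) ((tangentHomBundle φ).phi.symm y)) = _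
    rw [LinearEquiv.apply_symm_apply, ← phi_vecLie, phi_vecLie_eq, LinearEquiv.apply_symm_apply,
      LinearEquiv.apply_symm_apply]
    simp only [act_eq_pull_vecAct, pair_eq_pull_vecPair, vecPair_dual_phi_symm,
      LinearEquiv.apply_symm_apply, AlgEquiv.apply_symm_apply]
  have h3 : vecPair ((tangentHomLieAlgebroid φ).d0
      ((tangentHomLieAlgebroid φ).contrOne ((tangentHomBundle φ).phi.symm x)
        ((tangentHomBundle φ).dual.phi.symm η))) ((tangentHomBundle φ).phi y) =
      pull φ (vecAct y (vecPair η x)) := by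
    rw [vecPair_d0]
    change vecAct ((tangentHomBundle φ).phi y)
      (pair ((tangentHomBundle φ).dual.phi ((tangentHomBundle φ).dual.phi.symm η))
        ((tangentHomBundle φ).phi ((tangentHomBundle φ).phi.symm x))) = _
    rw [LinearEquiv.apply_symm_apply, LinearEquiv.apply_symm_apply, pair_eq_pull_vecPair,
      vecAct_phi_pull]
  refine (vecPair_add_left _ _ _).trans ?_
  refine (congrArg₂ (· + ·) (h1.trans h2) h3).trans ?_
  rw [map_sub]
  ring

/-- The value on `x` of the Koszul bracket of the `1`-forms `ξ` and `η` with respect to `s`. -/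
noncomputable def koszulVal
    (s : Sec E (E →L[ℝ] ℝ) (PullCotangent φ) → Sec E E (PullTangent φ))
    (ξ η : Sec E (E →L[ℝ] ℝ) (PullCotangent φ)) (x : Sec E E (PullTangent φ)) : SmoothFun E M :=
  vecAct (s ξ) (vecPair η x) - vecPair η (vecLie (s ξ) x)
    - (vecAct (s η) (vecPair ξ x) - vecPair ξ (vecLie (s η) x))
    - vecAct x (vecPair η (s ξ))

/-- Each of the three terms of the bracket is `Ad^†` of its untwisted counterpart, so evaluation on
`Ad x` pulls out a single `φ^*`. All later computations with the bracket go through this formula. -/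
theorem vecPair_cotangentBracket (P : Bisection E E (PullTangent φ))
    (ξ η : Sec E (E →L[ℝ] ℝ) (PullCotangent φ)) (x : Sec E E (PullTangent φ)) :
    vecPair (cotangentBracket φ P ξ η) ((tangentHomBundle φ).phi x) =
      pull φ (koszulVal P.sharpSec ξ η x) := by
  have h : vecPair (cotangentBracket φ P ξ η) ((tangentHomBundle φ).phi x) =
      vecPair ((tangentHomLieAlgebroid φ).lieDeriv (P.sharpSec ξ) η) ((tangentHomBundle φ).phi x)
      - vecPair ((tangentHomLieAlgebroid φ).lieDeriv (P.sharpSec η) ξ)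
          ((tangentHomBundle φ).phi x)
      - vecPair ((tangentHomLieAlgebroid φ).d0 (P.eval ξ η)) ((tangentHomBundle φ).phi x) := rfl
  rw [h, vecPair_lieDeriv, vecPair_lieDeriv, vecPair_d0, ← P.pair_sharpSec, pair_eq_pull_vecPair,
    vecAct_phi_pull, koszulVal]
  simp only [map_sub]

end Untwisted

/-! ### The morphism obstruction and its relation to the Schouten bracket. -/

section Defect

variable {E : Type*} [NormedAddCommGroup E] [NormedSpace ℝ E] [FiniteDimensional ℝ E]
  {M : Type*} [TopologicalSpace M] [ChartedSpace E M] [IsManifold 𝓘(ℝ, E) ∞ M] [T2Space M]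
  {φ : Diffeo E M}

/-- The map `(x ∧ y)^♯`. -/
noncomputable def sharpWedge (x y : Sec E E (PullTangent φ))
    (ξ : Sec E (E →L[ℝ] ℝ) (PullCotangent φ)) : Sec E E (PullTangent φ) :=
  pull φ (vecPair ξ x) • y - pull φ (vecPair ξ y) • x

/-- The polarized obstruction to `♯` being a morphism from the Koszul bracket to the Lie bracket,
paired with `ζ`. -/
noncomputable def koszulDefect
    (s t : Sec E (E →L[ℝ] ℝ) (PullCotangent φ) → Sec E E (PullTangent φ))
    (ξ η ζ : Sec E (E →L[ℝ] ℝ) (PullCotangent φ)) : SmoothFun E M :=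
  koszulVal s ξ η (t ζ) + vecPair ζ (vecLie (s ξ) (t η))

/-- Additivity in `s` and in `t` separately is what the polarization is for: once `P` is written as
a sum of wedges, only decomposable bivectors remain to be treated. -/
theorem koszulDefect_add_left
    (s s' t : Sec E (E →L[ℝ] ℝ) (PullCotangent φ) → Sec E E (PullTangent φ))
    (ξ η ζ : Sec E (E →L[ℝ] ℝ) (PullCotangent φ)) :
    koszulDefect (s + s') t ξ η ζ = koszulDefect s t ξ η ζ + koszulDefect s' t ξ η ζ := by
  simp only [koszulDefect, koszulVal, Pi.add_apply, vecAct_add_left, vecLie_add_left, vecPair_add,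
    vecAct_add]
  ring

theorem koszulDefect_add_right
    (s t t' : Sec E (E →L[ℝ] ℝ) (PullCotangent φ) → Sec E E (PullTangent φ))
    (ξ η ζ : Sec E (E →L[ℝ] ℝ) (PullCotangent φ)) :
    koszulDefect s (t + t') ξ η ζ = koszulDefect s t ξ η ζ + koszulDefect s t' ξ η ζ := by
  simp only [koszulDefect, koszulVal, Pi.add_apply, vecAct_add_left, vecLie_add_right, vecPair_add,
    vecAct_add]
  ring

theorem koszulDefect_sum_left {ι : Type*} (I : Finset ι)
    (s : ι → Sec E (E →L[ℝ] ℝ) (PullCotangent φ) → Sec E E (PullTangent φ))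
    (t : Sec E (E →L[ℝ] ℝ) (PullCotangent φ) → Sec E E (PullTangent φ))
    (ξ η ζ : Sec E (E →L[ℝ] ℝ) (PullCotangent φ)) :
    koszulDefect (∑ i ∈ I, s i) t ξ η ζ = ∑ i ∈ I, koszulDefect (s i) t ξ η ζ :=
  map_sum (AddMonoidHom.mk' (fun s => koszulDefect s t ξ η ζ)
    (fun s s' => koszulDefect_add_left s s' t ξ η ζ)) s I

theorem koszulDefect_sum_right {ι : Type*} (I : Finset ι)
    (s : Sec E (E →L[ℝ] ℝ) (PullCotangent φ) → Sec E E (PullTangent φ))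
    (t : ι → Sec E (E →L[ℝ] ℝ) (PullCotangent φ) → Sec E E (PullTangent φ))
    (ξ η ζ : Sec E (E →L[ℝ] ℝ) (PullCotangent φ)) :
    koszulDefect s (∑ i ∈ I, t i) ξ η ζ = ∑ i ∈ I, koszulDefect s (t i) ξ η ζ :=
  map_sum (AddMonoidHom.mk' (fun t => koszulDefect s t ξ η ζ)
    (fun t t' => koszulDefect_add_right s t t' ξ η ζ)) t I

/-- The value of `x ∧ y ∧ z` on three `1`-forms. -/
noncomputable def wedgeVal (x y z : Sec E E (PullTangent φ))
    (ξ η ζ : Sec E (E →L[ℝ] ℝ) (PullCotangent φ)) : SmoothFun E M :=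
  vecPair ξ x * vecPair η y * vecPair ζ z - vecPair ξ x * vecPair η z * vecPair ζ y
    - vecPair ξ y * vecPair η x * vecPair ζ z + vecPair ξ y * vecPair η z * vecPair ζ x
    + vecPair ξ z * vecPair η x * vecPair ζ y - vecPair ξ z * vecPair η y * vecPair ζ x

/-- By the derivation rules, both sides become polynomials in pairings, derivatives of pairings, and
pairings with brackets. In the symmetrized sum the derivatives of pairings cancel. The surviving
brackets, each between one of `a`, `b` and one of `c`, `d`, assemble into the Schouten bracket of `a
∧ b` and `c ∧ d`. -/
theorem koszulDefect_sharpWedge (a b c d : Sec E E (PullTangent φ))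
    (ξ η ζ : Sec E (E →L[ℝ] ℝ) (PullCotangent φ)) :
    koszulDefect (sharpWedge a b) (sharpWedge c d) ξ η ζ
      + koszulDefect (sharpWedge c d) (sharpWedge a b) ξ η ζ =
    wedgeVal (vecLie a c) b d ξ η ζ - wedgeVal (vecLie a d) b c ξ η ζ
      - wedgeVal (vecLie b c) a d ξ η ζ + wedgeVal (vecLie b d) a c ξ η ζ := by
  simp only [koszulDefect, koszulVal, sharpWedge, vecAct_sub_left, vecLie_sub_left,
    vecLie_sub_right, vecLie_pull_smul_left, vecLie_pull_smul_right, vecPair_sub, vecPair_add,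
    vecPair_pull_smul, vecAct_pull_smul, vecAct_sub, vecAct_mul]
  rw [vecLie_swap c a, vecLie_swap d a, vecLie_swap c b, vecLie_swap d b]
  simp only [vecPair_neg, wedgeVal]
  ring

theorem trivectorEval_ιMulti {V : Type*} [AddCommGroup V] [Module ℝ V] (x y z : V)
    (ξ η ζ : Module.Dual ℝ V) :
    exteriorPower.alternatingMapToDual ℝ V 3 ![ξ, η, ζ] (exteriorPower.ιMulti ℝ 3 ![x, y, z]) =
      ξ x * η y * ζ z - ξ x * η z * ζ y - ξ y * η x * ζ z + ξ y * η z * ζ x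
        + ξ z * η x * ζ y - ξ z * η y * ζ x := by
  simp [Matrix.det_fin_three]; ring

end Defect

/-! ### Consequences of `⟦P, P⟧ = 0` and `Ad P = P` for `P^♯`. -/

section Poisson

variable {E : Type*} [NormedAddCommGroup E] [NormedSpace ℝ E] [FiniteDimensional ℝ E]
  {M : Type*} [TopologicalSpace M] [ChartedSpace E M] [IsManifold 𝓘(ℝ, E) ∞ M] [T2Space M]
  {φ : Diffeo E M} {P : Bisection E E (PullTangent φ)}

theorem sharpSec_add (ξ η : Sec E (E →L[ℝ] ℝ) (PullCotangent φ)) :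
    P.sharpSec (ξ + η) = P.sharpSec ξ + P.sharpSec η := by
  ext m
  exact map_add (sharp (P.val m)) (ξ m : Module.Dual ℝ (PullTangent φ m)) (η m)

theorem sharpSec_smul (f : SmoothFun E M) (ξ : Sec E (E →L[ℝ] ℝ) (PullCotangent φ)) :
    P.sharpSec (f • ξ) = f • P.sharpSec ξ := by
  ext m
  exact map_smul (sharp (P.val m)) (f m) (ξ m : Module.Dual ℝ (PullTangent φ m))

theorem vecPair_sharpSec_swap (ξ η : Sec E (E →L[ℝ] ℝ) (PullCotangent φ)) :
    vecPair ξ (P.sharpSec η) = -vecPair η (P.sharpSec ξ) := by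
  rw [vecPair, vecPair, P.pair_sharpSec, P.pair_sharpSec, ← map_neg]
  congr 1
  ext m
  exact bivectorEval_swap _ _ _

theorem sharp_eq_sum_of_eq_sum {V ι : Type*} [AddCommGroup V] [Module ℝ V]
    [FiniteDimensional ℝ V] [Fintype ι] {p : ⋀[ℝ]^2 V} {x y : ι → V}
    (h : p = ∑ i, exteriorPower.ιMulti ℝ 2 ![x i, y i]) (ξ : Module.Dual ℝ V) :
    sharp p ξ = ∑ i, (ξ (x i) • y i - ξ (y i) • x i) := by
  refine sub_eq_zero.1 ((Module.forall_dual_apply_eq_zero_iff ℝ _).1 fun η => ?_)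
  have h1 : bivectorEval p ξ η = ∑ i, (ξ (x i) * η (y i) - ξ (y i) * η (x i)) := by
    rw [h, bivectorEval, map_sum]
    exact Finset.sum_congr rfl fun i _ => bivectorEval_ιMulti _ _ _ _
  rw [map_sub, apply_sharp, h1, map_sum, sub_eq_zero]
  simp only [map_sub, map_smul, smul_eq_mul]

theorem sharpSec_eq_sum {ι : Type*} [Fintype ι] {x y : ι → Sec E E (PullTangent φ)}
    (h : ∀ m, P.val m = ∑ i, exteriorPower.ιMulti ℝ 2 ![x i m, y i m]) :
    P.sharpSec = ∑ i, sharpWedge (x i) (y i) := by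
  funext ξ
  ext m
  rw [Finset.sum_apply, Sec.sum_apply]
  refine (sharp_eq_sum_of_eq_sum (h m) _).trans (Finset.sum_congr rfl fun i _ => ?_)
  rw [sharpWedge, ← pair_eq_pull_vecPair, ← pair_eq_pull_vecPair]
  rfl

theorem sharpWedge_phi (x y : Sec E E (PullTangent φ))
    (ξ : Sec E (E →L[ℝ] ℝ) (PullCotangent φ)) :
    sharpWedge ((tangentHomBundle φ).phi x) ((tangentHomBundle φ).phi y)
      ((tangentHomBundle φ).dual.phi ξ) = (tangentHomBundle φ).phi (sharpWedge x y ξ) := by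
  simp only [sharpWedge, map_sub, HomBundle.phi_smul, vecPair_dual_phi_phi]

/-- Invariance provides two presentations of the same `P`, one by `x i`, `y i` and one by their
images under `Ad`. Computing the left side with the second and the right side with the first reduces
the claim to naturality on decomposables. -/
theorem sharpSec_dual_phi (h : (tangentHomBundle φ).IsPhiTwo P P)
    (ξ : Sec E (E →L[ℝ] ℝ) (PullCotangent φ)) :
    P.sharpSec ((tangentHomBundle φ).dual.phi ξ) = (tangentHomBundle φ).phi (P.sharpSec ξ) := by
  obtain ⟨k, x, y, h1, h2⟩ := h
  conv_lhs => rw [sharpSec_eq_sum h2]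
  rw [sharpSec_eq_sum h1, Finset.sum_apply, Finset.sum_apply, map_sum]
  exact Finset.sum_congr rfl fun i _ => sharpWedge_phi _ _ _

/-- Two copies of `φ` appear at the base point: one because fibres at `m` live over `φ m`, the other
from the invariance of the pairing under `Ad^†` and `Ad`. Every entry of a Schouten term is in the
image of `Ad`, the bracket entry by `phi_vecLie`. -/
theorem trivectorEval_phi (x y z : Sec E E (PullTangent φ))
    (ξ η ζ : Sec E (E →L[ℝ] ℝ) (PullCotangent φ)) (m : M) :
    exteriorPower.alternatingMapToDual ℝ (PullTangent φ m) 3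
      ![((tangentHomBundle φ).dual.phi ξ m : Module.Dual ℝ (PullTangent φ m)),
        ((tangentHomBundle φ).dual.phi η m : Module.Dual ℝ (PullTangent φ m)),
        ((tangentHomBundle φ).dual.phi ζ m : Module.Dual ℝ (PullTangent φ m))]
      (exteriorPower.ιMulti ℝ 3 ![(tangentHomBundle φ).phi x m, (tangentHomBundle φ).phi y m,
        (tangentHomBundle φ).phi z m]) =
      wedgeVal x y z ξ η ζ (φ (φ m)) := by
  have h : ∀ (ξ : Sec E (E →L[ℝ] ℝ) (PullCotangent φ)) (x : Sec E E (PullTangent φ)),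
      ((tangentHomBundle φ).dual.phi ξ m : Module.Dual ℝ (PullTangent φ m))
        ((tangentHomBundle φ).phi x m) = vecPair ξ x (φ (φ m)) := fun ξ x => by
    have h := DFunLike.congr_fun (pair_eq_pull_vecPair ((tangentHomBundle φ).dual.phi ξ)
      ((tangentHomBundle φ).phi x)) m
    rw [vecPair_dual_phi_phi] at h
    exact h
  rw [trivectorEval_ιMulti]
  simp only [h]
  rfl

/-- Twice this function is the value of `⟦P, P⟧` on `Ad^†ξ`, `Ad^†η`, `Ad^†ζ`, moved from `m` to `φ
(φ m)`. -/
theorem koszulDefect_sharpSec (h : (tangentHomLieAlgebroid φ).IsSchouten P P (fun _ => 0))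
    (ξ η ζ : Sec E (E →L[ℝ] ℝ) (PullCotangent φ)) :
    koszulDefect P.sharpSec P.sharpSec ξ η ζ = 0 := by
  obtain ⟨k, l, x₁, x₂, y₁, y₂, hx, hy, h0⟩ := h
  have h1 : koszulDefect P.sharpSec P.sharpSec ξ η ζ = ∑ i, ∑ j,
      koszulDefect (sharpWedge (x₁ i) (x₂ i)) (sharpWedge (y₁ j) (y₂ j)) ξ η ζ := by
    conv_lhs => rw [sharpSec_eq_sum hx, ← sharpSec_eq_sum hx]
    conv_lhs => enter [1]; rw [sharpSec_eq_sum hx]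
    rw [sharpSec_eq_sum hy, koszulDefect_sum_left]
    exact Finset.sum_congr rfl fun i _ => koszulDefect_sum_right _ _ _ _ _ _
  -- The hypothesis comes with two unrelated presentations of `P`. Using them in the two slots in
  -- both orders makes the sum of `h1` and `h2` the symmetrization, term by term.
  have h2 : koszulDefect P.sharpSec P.sharpSec ξ η ζ = ∑ i, ∑ j,
      koszulDefect (sharpWedge (y₁ j) (y₂ j)) (sharpWedge (x₁ i) (x₂ i)) ξ η ζ := by
    conv_lhs => enter [2]; rw [sharpSec_eq_sum hx]
    rw [sharpSec_eq_sum hy, koszulDefect_sum_right]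
    exact Finset.sum_congr rfl fun i _ => koszulDefect_sum_left _ _ _ _ _ _
  have h3 : koszulDefect P.sharpSec P.sharpSec ξ η ζ + koszulDefect P.sharpSec P.sharpSec ξ η ζ
      = 0 := by
    conv_lhs => enter [1]; rw [h1]
    conv_lhs => enter [2]; rw [h2]
    simp only [← Finset.sum_add_distrib, koszulDefect_sharpWedge]
    -- Since `φ ∘ φ` is onto, it suffices to compare at the points where a value of the Schouten
    -- bracket is read off.
    ext p
    obtain ⟨m, rfl⟩ : ∃ m, φ (φ m) = p :=
      ⟨φ.symm (φ.symm p), by rw [φ.apply_symm_apply, φ.apply_symm_apply]⟩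
    have h4 := congrArg (exteriorPower.alternatingMapToDual ℝ (PullTangent φ m) 3
      ![((tangentHomBundle φ).dual.phi ξ m : Module.Dual ℝ (PullTangent φ m)),
        ((tangentHomBundle φ).dual.phi η m : Module.Dual ℝ (PullTangent φ m)),
        ((tangentHomBundle φ).dual.phi ζ m : Module.Dual ℝ (PullTangent φ m))]) (h0 m)
    rw [map_zero, map_sum] at h4
    have hsum : ∀ {n : ℕ} (g : Fin n → SmoothFun E M) (p : M),
        (∑ i, g i) p = ∑ i, g i p := fun g p => by
      have := congrFun (map_sum (ContMDiffMap.coeFnAddMonoidHom (I := 𝓘(ℝ, E))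
        (I' := 𝓘(ℝ, ℝ)) (N := M) (n := ∞) (G := ℝ)) g Finset.univ) p
      simpa using this
    rw [hsum]
    refine Eq.trans (Finset.sum_congr rfl fun i _ => ?_) h4.symm
    rw [hsum, map_sum]
    refine Finset.sum_congr rfl fun j _ => ?_
    rw [HomLieAlgebroid.schoutenTerm]
    change _ = exteriorPower.alternatingMapToDual ℝ (PullTangent φ m) 3 _
      (exteriorPower.ιMulti ℝ 3 ![tangentBracket φ (x₁ i) (y₁ j) m,
          (tangentHomBundle φ).phi (x₂ i) m, (tangentHomBundle φ).phi (y₂ j) m]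
        - exteriorPower.ιMulti ℝ 3 ![tangentBracket φ (x₁ i) (y₂ j) m,
          (tangentHomBundle φ).phi (x₂ i) m, (tangentHomBundle φ).phi (y₁ j) m]
        - exteriorPower.ιMulti ℝ 3 ![tangentBracket φ (x₂ i) (y₁ j) m,
          (tangentHomBundle φ).phi (x₁ i) m, (tangentHomBundle φ).phi (y₂ j) m]
        + exteriorPower.ιMulti ℝ 3 ![tangentBracket φ (x₂ i) (y₂ j) m,
          (tangentHomBundle φ).phi (x₁ i) m, (tangentHomBundle φ).phi (y₁ j) m])
    simp only [← phi_vecLie, map_add, map_sub, trivectorEval_phi]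
    rfl
  ext p
  have h5 : koszulDefect P.sharpSec P.sharpSec ξ η ζ p
      + koszulDefect P.sharpSec P.sharpSec ξ η ζ p = 0 := DFunLike.congr_fun h3 p
  change koszulDefect P.sharpSec P.sharpSec ξ η ζ p = 0
  linarith

/-- By skew-symmetry of `P`, the vanishing obstruction reads `ζ(P^♯[ξ, η]) = ζ([P^♯ξ, P^♯η])` for
the untwisted brackets; equivariance of `P^♯` then restores the `Ad`. -/
theorem sharpSec_cotangentBracket (hP : IsHomPoisson φ P)
    (ξ η : Sec E (E →L[ℝ] ℝ) (PullCotangent φ)) :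
    P.sharpSec (cotangentBracket φ P ξ η) =
      (tangentHomBundle φ).phi (vecLie (P.sharpSec ξ) (P.sharpSec η)) := by
  refine eq_of_forall_vecPair fun ζ => ?_
  -- Testing against `Ad^†ζ` turns the argument of the bracket into `Ad (P^♯ζ)`, the form in which
  -- its value is known.
  obtain ⟨ζ, rfl⟩ := (tangentHomBundle φ).dual.phi.surjective ζ
  rw [vecPair_sharpSec_swap, sharpSec_dual_phi hP.2, vecPair_cotangentBracket,
    vecPair_dual_phi_phi, ← map_neg]
  congr 1
  have h := koszulDefect_sharpSec hP.1 ξ η ζ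
  rw [koszulDefect] at h
  linear_combination -h

/-! ### The algebroid axioms for the cotangent bracket. -/

theorem vecPair_phi_ext {ξ η : Sec E (E →L[ℝ] ℝ) (PullCotangent φ)}
    (h : ∀ x, vecPair ξ ((tangentHomBundle φ).phi x) = vecPair η ((tangentHomBundle φ).phi x)) :
    ξ = η :=
  vecPair_ext fun x => by
    obtain ⟨x, rfl⟩ := (tangentHomBundle φ).phi.surjective x
    exact h x

theorem vecPair_smul_left (f : SmoothFun E M) (ξ : Sec E (E →L[ℝ] ℝ) (PullCotangent φ))
    (x : Sec E E (PullTangent φ)) :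
    vecPair (pull φ f • ξ) x = f * vecPair ξ x := by
  rw [vecPair, smul_pair, map_mul, AlgEquiv.symm_apply_apply, vecPair]

theorem vecPair_neg_left (ξ : Sec E (E →L[ℝ] ℝ) (PullCotangent φ))
    (x : Sec E E (PullTangent φ)) : vecPair (-ξ) x = -vecPair ξ x := by
  rw [eq_neg_iff_add_eq_zero, ← vecPair_add_left, neg_add_cancel]
  exact map_zero (pull φ).symm

theorem cotangentBracket_swap (ξ η : Sec E (E →L[ℝ] ℝ) (PullCotangent φ)) :
    cotangentBracket φ P ξ η = -cotangentBracket φ P η ξ :=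
  vecPair_phi_ext fun x => by
    rw [vecPair_neg_left, vecPair_cotangentBracket, vecPair_cotangentBracket, ← map_neg]
    simp only [koszulVal, vecPair_sharpSec_swap η ξ, vecAct_neg]
    ring_nf

theorem cotangentBracket_add_right (ξ η ζ : Sec E (E →L[ℝ] ℝ) (PullCotangent φ)) :
    cotangentBracket φ P ξ (η + ζ) = cotangentBracket φ P ξ η + cotangentBracket φ P ξ ζ :=
  vecPair_phi_ext fun x => by
    rw [vecPair_add_left, vecPair_cotangentBracket, vecPair_cotangentBracket,
      vecPair_cotangentBracket, ← map_add]
    simp only [koszulVal, sharpSec_add, vecPair_add_left, vecAct_add, vecAct_add_left,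
      vecLie_add_left, vecPair_add]
    ring_nf

/-- Untwisted, `L_{f P^♯η} ξ` contributes `ξ(P^♯η) df` and `d(f P(ξ, η))` contributes `P(ξ, η) df`.
These cancel because `ξ(P^♯η) = -P(ξ, η)`, so only the derivative of `f` along `P^♯ξ` survives. -/
theorem cotangentBracket_smul (hP : IsHomPoisson φ P)
    (ξ η : Sec E (E →L[ℝ] ℝ) (PullCotangent φ)) (f : SmoothFun E M) :
    cotangentBracket φ P ξ (f • η) = pull φ f • cotangentBracket φ P ξ η +
      act (P.sharpSec ((tangentHomBundle φ).dual.phi ξ)) f • (tangentHomBundle φ).dual.phi η :=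
  vecPair_phi_ext fun x => by
    -- Writing `f = φ^*g` makes `f • η` the ordinary product of the function `g` with the `1`-form.
    obtain ⟨g, rfl⟩ := (pull φ).surjective f
    rw [vecPair_add_left, act_eq_pull_vecAct, vecPair_smul_left, vecPair_smul_left,
      sharpSec_dual_phi hP.2, vecAct_phi_pull, vecPair_dual_phi_phi, vecPair_cotangentBracket,
      vecPair_cotangentBracket, ← map_mul, ← map_mul, ← map_add]
    congr 1
    simp only [koszulVal, sharpSec_smul, vecPair_smul_left, vecAct_mul, vecAct_pull_smul,
      vecLie_pull_smul_left, vecPair_sub, vecPair_pull_smul, vecPair_sharpSec_swap ξ η]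
    ring

theorem act_const (x : Sec E E (PullTangent φ)) (c : ℝ) :
    act x (ContMDiffMap.const c : SmoothFun E M) = 0 := by
  ext m
  have h : mfderiv 𝓘(ℝ, E) 𝓘(ℝ, ℝ) (ContMDiffMap.const c : SmoothFun E M) (φ m) = 0 :=
    mfderiv_const
  exact congrArg (fun L => L (x m)) h

/-- Real homogeneity is the Leibniz rule for a constant function, whose derivative along the anchor
vanishes. -/
theorem cotangentBracket_real_smul (hP : IsHomPoisson φ P)
    (ξ η : Sec E (E →L[ℝ] ℝ) (PullCotangent φ)) (c : ℝ) :
    cotangentBracket φ P ξ (c • η) = c • cotangentBracket φ P ξ η := by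
  have h := cotangentBracket_smul hP ξ η (ContMDiffMap.const c)
  have h0 : (0 : SmoothFun E M) • (tangentHomBundle φ).dual.phi η = 0 := by
    ext m : 1
    exact zero_smul ℝ _
  rw [act_const, h0, add_zero] at h
  exact h

/-- The Koszul bracket is built from pairing, derivative, Lie bracket and `P^♯`, all of which are
equivariant; only the last needs the invariance of `P`. -/
theorem koszulVal_phi (hP : IsHomPoisson φ P) (ξ η : Sec E (E →L[ℝ] ℝ) (PullCotangent φ))
    (x : Sec E E (PullTangent φ)) :
    koszulVal P.sharpSec ((tangentHomBundle φ).dual.phi ξ) ((tangentHomBundle φ).dual.phi η)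
      ((tangentHomBundle φ).phi x) = pull φ (koszulVal P.sharpSec ξ η x) := by
  simp only [koszulVal, sharpSec_dual_phi hP.2, vecPair_dual_phi_phi, vecAct_phi_pull,
    ← phi_vecLie_eq, map_sub]

theorem phi_cotangentBracket (hP : IsHomPoisson φ P)
    (ξ η : Sec E (E →L[ℝ] ℝ) (PullCotangent φ)) :
    (tangentHomBundle φ).dual.phi (cotangentBracket φ P ξ η) =
      cotangentBracket φ P ((tangentHomBundle φ).dual.phi ξ)
        ((tangentHomBundle φ).dual.phi η) :=
  vecPair_phi_ext fun x => by
    obtain ⟨x, rfl⟩ := (tangentHomBundle φ).phi.surjective x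
    rw [vecPair_dual_phi_phi, vecPair_cotangentBracket, vecPair_cotangentBracket,
      koszulVal_phi hP]

/-- The morphism property replaces `P^♯` of the inner bracket by a Lie bracket of vector fields. The
structure map on the outer `ξ` matches the `Ad^†` hidden in the inner bracket, so one `φ^*` factors
out of the whole expression. -/
theorem koszulVal_cotangentBracket (hP : IsHomPoisson φ P)
    (ξ η ζ : Sec E (E →L[ℝ] ℝ) (PullCotangent φ)) (x : Sec E E (PullTangent φ)) :
    koszulVal P.sharpSec ((tangentHomBundle φ).dual.phi ξ) (cotangentBracket φ P η ζ)
      ((tangentHomBundle φ).phi x) =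
    pull φ (vecAct (P.sharpSec ξ) (koszulVal P.sharpSec η ζ x)
      - koszulVal P.sharpSec η ζ (vecLie (P.sharpSec ξ) x)
      - (vecAct (vecLie (P.sharpSec η) (P.sharpSec ζ)) (vecPair ξ x)
        - vecPair ξ (vecLie (vecLie (P.sharpSec η) (P.sharpSec ζ)) x))
      - vecAct x (koszulVal P.sharpSec η ζ (P.sharpSec ξ))) := by
  rw [koszulVal, sharpSec_dual_phi hP.2, sharpSec_cotangentBracket hP]
  simp only [← phi_vecLie_eq, vecPair_dual_phi_phi, vecPair_cotangentBracket, vecAct_phi_pull,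
    map_sub]

/-- In the cyclic sum, the iterated derivatives of `ξ(x)`, `η(x)`, `ζ(x)` and the pairings with
iterated Lie brackets cancel by the commutator and Jacobi identities for vector fields. Only
derivatives along `x` of the obstruction remain. -/
theorem cotangentBracket_jacobi (hP : IsHomPoisson φ P)
    (ξ η ζ : Sec E (E →L[ℝ] ℝ) (PullCotangent φ)) :
    cotangentBracket φ P ((tangentHomBundle φ).dual.phi ξ) (cotangentBracket φ P η ζ)
      + cotangentBracket φ P ((tangentHomBundle φ).dual.phi η) (cotangentBracket φ P ζ ξ)
      + cotangentBracket φ P ((tangentHomBundle φ).dual.phi ζ) (cotangentBracket φ P ξ η)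
      = 0 :=
  vecPair_phi_ext fun x => by
    -- Each of the two nested brackets carries one twist, so the test vector is `Ad (Ad x)` and two
    -- factors `φ^*` are removed below.
    obtain ⟨x, rfl⟩ := (tangentHomBundle φ).phi.surjective x
    have hzero : vecPair (0 : Sec E (E →L[ℝ] ℝ) (PullCotangent φ))
        ((tangentHomBundle φ).phi ((tangentHomBundle φ).phi x)) = 0 := map_zero (pull φ).symm
    rw [vecPair_add_left, vecPair_add_left, hzero]
    simp only [vecPair_cotangentBracket, koszulVal_cotangentBracket hP, ← map_add]
    rw [map_eq_zero_iff _ (pull φ).injective, map_eq_zero_iff _ (pull φ).injective]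
    have h1 := congrArg (vecAct x) (koszulDefect_sharpSec hP.1 ξ η ζ)
    have h0 := vecAct_sub x 0 0
    rw [sub_self, sub_self] at h0
    rw [h0] at h1
    -- The skew-symmetry rules are instantiated at specific pairs: this fixes one orientation of
    -- each pairing and bracket, and keeps the rewriting from looping.
    simp only [koszulDefect, koszulVal, vecAct_add, vecAct_sub, vecAct_neg, vecPair_neg,
      vecPair_sub, vecLie_vecLie_left, vecAct_vecLie,
      vecPair_sharpSec_swap ξ η, vecPair_sharpSec_swap η ζ, vecPair_sharpSec_swap ζ ξ,
      vecLie_swap (P.sharpSec η) (P.sharpSec ξ), vecLie_swap (P.sharpSec ζ) (P.sharpSec η),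
      vecLie_swap (P.sharpSec ξ) (P.sharpSec ζ)] at h1 ⊢
    -- Let `D` be the obstruction, `B` the cyclic sum of `ξ([P^♯η, P^♯ζ])` and `C` that of
    -- `P^♯ξ(P(η, ζ))`, so that `D = B - C`. The last terms of the three brackets give `-x(3D - B)`,
    -- and the exact terms inside the inner brackets give `-x(C)`; together they make `-2 x(D)`.
    linear_combination -2 * h1

end Poisson

/-! ### Smoothness of `P^♯` as a bundle map. -/

section Anchor

variable {E : Type*} [NormedAddCommGroup E] [NormedSpace ℝ E] [FiniteDimensional ℝ E]
  {M : Type*} [TopologicalSpace M] [ChartedSpace E M] [IsManifold 𝓘(ℝ, E) ∞ M] [T2Space M]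
  {φ : Diffeo E M} {P : Bisection E E (PullTangent φ)}

/-- The pairing with a section of `φ^!TM` is smooth on the total space of `φ^!T^*M`. -/
theorem contMDiff_totalSpace_apply (x : Sec E E (PullTangent φ)) :
    ContMDiff (𝓘(ℝ, E).prod 𝓘(ℝ, E →L[ℝ] ℝ)) 𝓘(ℝ, ℝ) ∞
      (fun v : TotalSpace (E →L[ℝ] ℝ) (PullCotangent φ) => v.2 (x v.proj)) := by
  have hp : ContMDiff (𝓘(ℝ, E).prod 𝓘(ℝ, E →L[ℝ] ℝ)) 𝓘(ℝ, E) ∞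
      (TotalSpace.proj : TotalSpace (E →L[ℝ] ℝ) (PullCotangent φ) → M) :=
    contMDiff_proj _
  -- The identity of the total space is regarded as the tautological covector field over the
  -- projection, and is applied to the section `x` pulled back along that projection.
  have h := ContMDiff.clm_bundle_apply (IM := 𝓘(ℝ, E).prod 𝓘(ℝ, E →L[ℝ] ℝ)) (IB := 𝓘(ℝ, E))
    (F₁ := E) (F₂ := ℝ) (E₁ := PullTangent φ)
    (E₂ := Bundle.Trivial M ℝ)
    (b := fun v : TotalSpace (E →L[ℝ] ℝ) (PullCotangent φ) => v.proj)
    (ϕ := fun v => v.2) (v := fun v => x v.proj) contMDiff_id (x.contMDiff.comp hp)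
  intro v
  exact (contMDiffAt_totalSpace.1 (h v)).2

/-- An anchor must be smooth on the total space, not only on sections. The formula `P^♯ξ = ∑ (ξ(x_i)
y_i - ξ(y_i) x_i)` gives this, as its coefficients are smooth in the covector and the base point
jointly. -/
theorem contMDiff_sharp {ι : Type*} [Fintype ι] {x y : ι → Sec E E (PullTangent φ)}
    (h : ∀ m, P.val m = ∑ i, exteriorPower.ιMulti ℝ 2 ![x i m, y i m]) :
    ContMDiff (𝓘(ℝ, E).prod 𝓘(ℝ, E →L[ℝ] ℝ)) (𝓘(ℝ, E).prod 𝓘(ℝ, E)) ∞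
      (fun v : TotalSpace (E →L[ℝ] ℝ) (PullCotangent φ) =>
        TotalSpace.mk' E (E := PullTangent φ) v.proj (sharp (P.val v.proj) v.2)) := by
  intro v₀
  have hp : ContMDiff (𝓘(ℝ, E).prod 𝓘(ℝ, E →L[ℝ] ℝ)) 𝓘(ℝ, E) ∞
      (TotalSpace.proj : TotalSpace (E →L[ℝ] ℝ) (PullCotangent φ) → M) :=
    contMDiff_proj _
  set e := trivializationAt E (PullTangent φ) v₀.proj
  have hsec : ∀ z : Sec E E (PullTangent φ), ContMDiffAt (𝓘(ℝ, E).prod 𝓘(ℝ, E →L[ℝ] ℝ)) 𝓘(ℝ, E) ∞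
      (fun v : TotalSpace (E →L[ℝ] ℝ) (PullCotangent φ) =>
        (e (TotalSpace.mk' E v.proj (z v.proj))).2) v₀ := fun z =>
    (contMDiffAt_totalSpace.1 (z.contMDiff.comp hp v₀)).2
  refine contMDiffAt_totalSpace.2 ⟨hp v₀, ?_⟩
  have hsum : ContMDiffAt (𝓘(ℝ, E).prod 𝓘(ℝ, E →L[ℝ] ℝ)) 𝓘(ℝ, E) ∞
      (fun v : TotalSpace (E →L[ℝ] ℝ) (PullCotangent φ) =>
        ∑ i, (v.2 (x i v.proj) • (e (TotalSpace.mk' E v.proj (y i v.proj))).2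
          - v.2 (y i v.proj) • (e (TotalSpace.mk' E v.proj (x i v.proj))).2)) v₀ :=
    ContMDiffAt.sum (I := 𝓘(ℝ, E)) fun i _ =>
      ((contMDiff_totalSpace_apply (x i) v₀).smul (hsec (y i))).sub
        ((contMDiff_totalSpace_apply (y i) v₀).smul (hsec (x i)))
  refine hsum.congr_of_eventuallyEq ?_
  have hbase : ∀ᶠ v : TotalSpace (E →L[ℝ] ℝ) (PullCotangent φ) in 𝓝 v₀, v.proj ∈ e.baseSet :=
    hp.continuous.continuousAt.eventually
      (e.open_baseSet.mem_nhds (FiberBundle.mem_baseSet_trivializationAt' v₀.proj))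
  filter_upwards [hbase] with v hv
  have hlin : ∀ z : PullTangent φ v.proj,
      (e (TotalSpace.mk' E v.proj z)).2 = e.linearMapAt ℝ v.proj z := fun z => by
    rw [e.linearMapAt_apply, if_pos hv]
  change (e (TotalSpace.mk' E v.proj (sharp (P.val v.proj) v.2))).2 = _
  simp only [hlin]
  rw [sharp_eq_sum_of_eq_sum (h v.proj), map_sum]
  simp only [map_sub, map_smul]
  rfl

/-- The anchor `P^♯` of the cotangent Hom-Lie algebroid. -/
noncomputable def sharpAnchor {ι : Type*} [Fintype ι] {x y : ι → Sec E E (PullTangent φ)}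
    (h : ∀ m, P.val m = ∑ i, exteriorPower.ιMulti ℝ 2 ![x i m, y i m]) :
    AnchorMap (E →L[ℝ] ℝ) (PullCotangent φ) φ where
  toFun m := sharp (P.val m) ∘ₗ ContinuousLinearMap.coeLM ℝ
  contMDiff := contMDiff_sharp h

end Anchor

end HomPoisson

/-! ### The cotangent Hom-Lie algebroid. -/

theorem mainTheorem1 {E : Type*} [NormedAddCommGroup E] [NormedSpace ℝ E] [FiniteDimensional ℝ E]
    {M : Type*} [TopologicalSpace M] [ChartedSpace E M] [IsManifold 𝓘(ℝ, E) ∞ M]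
    [T2Space M] [SecondCountableTopology M]
    (φ : Diffeo E M)
    (P : Bisection E E (PullTangent φ))
    (hP : IsHomPoisson φ P) :
    ∃ 𝒜 : HomLieAlgebroid (E →L[ℝ] ℝ) (PullCotangent φ) φ,
      𝒜.toHomBundle = (tangentHomBundle φ).dual ∧
      (∀ ξ η, 𝒜.bracket ξ η = cotangentBracket φ P ξ η) ∧
      (∀ (m : M) (ξ : PullCotangent φ m),
        𝒜.anchor.toFun m ξ = sharp (P.val m) ξ) := by
  -- The invariance hypothesis includes a presentation of `P` as a finite sum of wedges of global
  -- sections; here it serves only for the smoothness of the anchor.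
  obtain ⟨k, x, y, hxy, -⟩ := hP.2
  refine ⟨{
    toHomBundle := (tangentHomBundle φ).dual
    bracket := LinearMap.mk₂ ℝ (cotangentBracket φ P)
      (fun ξ η ζ => by
        rw [cotangentBracket_swap, cotangentBracket_add_right, neg_add, ← cotangentBracket_swap,
          ← cotangentBracket_swap])
      (fun c ξ η => by
        rw [cotangentBracket_swap, cotangentBracket_real_smul hP, cotangentBracket_swap ξ]
        ext m : 1
        exact (smul_neg c _).symm)
      cotangentBracket_add_right
      (fun c ξ η => cotangentBracket_real_smul hP ξ η c)
    bracket_skew := cotangentBracket_swap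
    phi_bracket := phi_cotangentBracket hP
    hom_jacobi := cotangentBracket_jacobi hP
    anchor := sharpAnchor hxy
    leibniz := cotangentBracket_smul hP
    anchor_phi := fun ξ f => ?_
    anchor_bracket := fun ξ η f => ?_ }, rfl, fun _ _ => rfl, fun _ _ => rfl⟩
  -- Since `P^♯` commutes with the structure maps and the brackets, both anchor axioms are those of
  -- the tangent Hom-Lie algebroid at `P^♯ξ` and `P^♯η`.
  · change act (P.sharpSec ((tangentHomBundle φ).dual.phi ξ)) (pull φ f) =
      pull φ (act (P.sharpSec ξ) f)
    rw [sharpSec_dual_phi hP.2]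
    exact (tangentHomLieAlgebroid φ).anchor_phi _ _
  · change act (P.sharpSec (cotangentBracket φ P ξ η)) (pull φ f) =
      act (P.sharpSec ((tangentHomBundle φ).dual.phi ξ)) (act (P.sharpSec η) f)
        - act (P.sharpSec ((tangentHomBundle φ).dual.phi η)) (act (P.sharpSec ξ) f)
    rw [sharpSec_cotangentBracket hP, phi_vecLie, sharpSec_dual_phi hP.2, sharpSec_dual_phi hP.2]
    exact (tangentHomLieAlgebroid φ).anchor_bracket _ _ _
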